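/- **Theorem.** Let $R$ be a commutative ring with unit and $X$ a simplicial set with face operators $\partial_i$ and degeneracy operators $s_i$. Let $C^N_n(X)$ be the free $R$-module on $X_n$ modulo the span of the degenerate $n$-simplices, and $(C^N_*(X)\otimes C^N_*(X))_k=\bigoplus_{p+q=k}C^N_p(X)\otimes_R C^N_q(X)$. Consider the Alexander–Whitney and Shih operators of the Eilenberg–Zilber contraction from $C^N_*(X\times X)$ onto $C^N_*(X)\otimes C^N_*(X)$, namely, for $a,b\in X_m$, $$AW(a\times b)=\sum_{i=0}^m\partial_{i+1}\cdots\partial_m a\otimes\partial_0\cdots\partial_{i-1}b,$$ $$SHI(a\times b)=\sum(-1)^{\bar m+\mathrm{sig}(\alpha,\beta)+1}\,s_{\beta_q+\bar m}\cdots s_{\beta_1+\bar m}s_{\bar m-1}\partial_{m-q+1}\cdots\partial_m a\times s_{\alpha_{p+1}+\bar m}\cdots s_{\alpha_1+\bar m}\partial_{\bar m}\cdots\partial_{m-q-1}b,$$ where $\bar m=m-p-q$, $\mathrm{sig}(\alpha,\beta)=\sum_{i=1}^{p+1}(\alpha_i-(i-1))$, and the sum is over $0\le q\le m-1$, $0\le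 p\le m-q-1$ and all $(p+1,q)$-shuffles $(\alpha,\beta)$, i.e. partitions of $\{0,\dots,p+q\}$ into $\alpha_1<\dots<\alpha_{p+1}$ and $\beta_1<\dots<\beta_q$ (so $SHI=0$ for $m=0$). Let $t(a\times b)=b\times a$. For $n,m\ge0$ let $$h_n=AW(t\,SHI)^n:\ C^N_m(X\times X)\to(C^N_*(X)\otimes C^N_*(X))_{m+n}.$$ Then for all $a,b\in X_m$: * if $n$ is even, $$h_n(a\times b)=\sum_{i_n=n}^{m}\ \sum_{i_{n-1}=n-1}^{i_n-1}\cdots\sum_{i_0=0}^{i_1-1}(-1)^{A+B+C+D}\;\partial_{i_0+1}\cdots\partial_{i_1-1}\,\partial_{i_2+1}\cdots\partial_{i_{n-1}-1}\,\partial_{i_n+1}\cdots\partial_m\,a\ \otimes\ \partial_0\cdots\partial_{i_0-1}\,\partial_{i_1+1}\cdots\partial_{i_{n-2}-1}\,\partial_{i_{n-1}+1}\cdots\partial_{i_n-1}\,b;$$ * if $n$ is odd (where $t^n$ exchanges the two arguments), $$h_n(a\times b)=\sum_{i_n=n}^{m}\ \sum_{i_{n-1}=n-1}^{i_n-1}\cdots\sum_{i_0=0}^{i_1-1}(-1)^{A+B+C+D}\;\partial_{i_0+1}\cdots\partial_{i_1-1}\,\partial_{i_2+1}\cdots\partial_{i_{n-2}-1}\,\partial_{i_{n-1}+1}\cdots\partial_{i_n-1}\,b\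 \otimes\ \partial_0\cdots\partial_{i_0-1}\,\partial_{i_1+1}\cdots\partial_{i_{n-1}-1}\,\partial_{i_n+1}\cdots\partial_m\,a.$$ That is, with $i_{n+1}=m+1$, the blocks $\partial_{i_k+1}\cdots\partial_{i_{k+1}-1}$ with $k$ even occur in the first factor, and $\partial_0\cdots\partial_{i_0-1}$ followed by the blocks with $k$ odd in the second. In particular only face operators occur. The exponents, with $\bar\imath=(i_0,\dots,i_n)$, are $A=A(n)$, $B=B(n,m,\bar\imath)$, $C=C(n,\bar\imath)$, $D=D(n,m,\bar\imath)$, where $$A(n)=\begin{cases}1,&n\equiv3,4,5,6\pmod 8,\\0,&\text{otherwise,}\end{cases}\qquad B(n,m,\bar\imath)=\begin{cases}\sum_{j=0}^{\lfloor n/2\rfloor}i_{2j},&n\equiv1,2\pmod 4,\\ \sum_{j=0}^{\lfloor (n-1)/2\rfloor}i_{2j+1}+nm,&n\equiv0,3\pmod 4,\end{cases}$$ $$C(n,\bar\imath)=\sum_{j=1}^{\lfloor n/2\rfloor}(i_{2j}+i_{2j-1})(i_{2j-1}+\cdots+i_0),\qquad D(n,m,\bar\imath)=\begin{cases}(m+i_n)(i_n+\cdots+i_0),&n\text{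 odd},\\0,&n\text{ even.}\end{cases}$$ Empty sums are $0$ (so $h_n=0$ on $C^N_m(X\times X)$ for $n>m$), and empty strings of operators are the identity. -/

import Mathlib

universe u v

namespace EilenbergZilber

noncomputable section

open CategoryTheory TensorProduct MonoidalCategory

local notation "⦋" n "⦌" => SimplexCategory.mk n

/-- The set of `n`-simplices of a simplicial set. -/
abbrev Simplex (X : SSet.{u}) (n : ℕ) : Type u := X.obj (Opposite.op ⦋n⦌)

/-- The face operator `∂ i` on `n`-simplices. It is used for `1 ≤ n` and `i ≤ n` only; the values
in the remaining cases are irrelevant. -/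
def face (X : SSet.{u}) (i : ℕ) : {n : ℕ} → Simplex X n → Simplex X (n - 1)
  | 0, x => x
  | n + 1, x => X.δ (⟨min i (n + 1), by omega⟩ : Fin (n + 2)) x

/-- The degeneracy operator `s i` on `n`-simplices. It is used for `i ≤ n` only; the value in the
remaining case is irrelevant. -/
def degen (X : SSet.{u}) (i : ℕ) {n : ℕ} (x : Simplex X n) : Simplex X (n + 1) :=
  X.σ (⟨min i n, by omega⟩ : Fin (n + 1)) x

/-- `faces X [j₁, …, jₛ]` is the composite `∂ j₁ ⋯ ∂ jₛ` (the operator `∂ jₛ` acts first). -/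
def faces (X : SSet.{u}) {m : ℕ} : (l : List ℕ) → Simplex X m → Simplex X (m - l.length)
  | [], x => x
  | i :: l, x => face X i (faces X l x)

/-- `degens X [j₁, …, jₛ]` is the composite `s j₁ ⋯ s jₛ` (the operator `s jₛ` acts first). -/
def degens (X : SSet.{u}) {m : ℕ} : (l : List ℕ) → Simplex X m → Simplex X (m + l.length)
  | [], x => x
  | i :: l, x => degen X i (degens X l x)

/-- Transport of a simplex along an equality of dimensions. -/
def castDim {X : SSet.{u}} {m n : ℕ} (h : m = n) (x : Simplex X m) : Simplex X n := h ▸ x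

/-- The list of consecutive integers `a, a + 1, …, b - 1` (empty if `b ≤ a`). -/
def consec (a b : ℕ) : List ℕ := List.range' a (b - a)

/-! ### Effect of the operators on vertices

The next facts serve only to show that the operators below are well defined on normalized
chains. -/

/-- The coface map, as a map on natural numbers. -/
def dFun (i j : ℕ) : ℕ := if j < i then j else j + 1

/-- The codegeneracy map, as a map on natural numbers. -/
def sFun (i j : ℕ) : ℕ := if j ≤ i then j else j - 1

/-- The vertex map of a composite of face operators. -/
def facesFun : List ℕ → ℕ → ℕ
  | [], j => j
  | i :: l, j => facesFun l (dFun i j)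

/-- The vertex map of a composite of degeneracy operators. -/
def degensFun : List ℕ → ℕ → ℕ
  | [], j => j
  | i :: l, j => degensFun l (sFun i j)

lemma face_eq_map (X : SSet.{u}) (i n : ℕ) (hn : 0 < n) (x : Simplex X n) :
    ∃ θ : ⦋n - 1⦌ ⟶ ⦋n⦌, face X i x = X.map θ.op x ∧
      ∀ j : Fin (n - 1 + 1), (θ.toOrderHom j : ℕ) = dFun i j := by
  obtain _ | n := n
  · omega
  refine ⟨SimplexCategory.δ (⟨min i (n + 1), by omega⟩ : Fin (n + 2)), rfl, fun j => ?_⟩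
  have hj := j.2
  simp only [Nat.add_sub_cancel] at hj
  change ((Fin.succAbove (⟨min i (n + 1), _⟩ : Fin (n + 2)) j : Fin (n + 2)) : ℕ) = _
  unfold Fin.succAbove dFun
  simp only [Fin.lt_def, Fin.val_castSucc]
  split_ifs <;> first | rfl | omega

lemma degen_eq_map (X : SSet.{u}) (i n : ℕ) (hi : i ≤ n) (x : Simplex X n) :
    ∃ θ : ⦋n + 1⦌ ⟶ ⦋n⦌, degen X i x = X.map θ.op x ∧
      ∀ j : Fin (n + 1 + 1), (θ.toOrderHom j : ℕ) = sFun i j := by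
  refine ⟨SimplexCategory.σ (⟨min i n, by omega⟩ : Fin (n + 1)), rfl, fun j => ?_⟩
  change ((Fin.predAbove (⟨min i n, _⟩ : Fin (n + 1)) j : Fin (n + 1)) : ℕ) = _
  unfold Fin.predAbove sFun
  simp only [Fin.lt_def, Fin.val_castSucc]
  split_ifs <;> first | omega | simp

lemma faces_eq_map (X : SSet.{u}) {m : ℕ} (x : Simplex X m) : ∀ l : List ℕ, l.length ≤ m →
    ∃ θ : ⦋m - l.length⦌ ⟶ ⦋m⦌, faces X l x = X.map θ.op x ∧
      ∀ j : Fin (m - l.length + 1), (θ.toOrderHom j : ℕ) = facesFun l j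
  | [], _ => ⟨𝟙 _, by simp [faces], fun j => rfl⟩
  | i :: l, hl => by
    simp only [List.length_cons] at hl
    obtain ⟨θ, h1, h2⟩ := faces_eq_map X x l (by omega)
    obtain ⟨η, h3, h4⟩ := face_eq_map X i (m - l.length) (by omega) (faces X l x)
    refine ⟨η ≫ θ, ?_, fun j => ?_⟩
    · rw [op_comp, X.map_comp]
      change face X i (faces X l x) = X.map η.op (X.map θ.op x)
      rw [h3, h1]
    · change (θ.toOrderHom (η.toOrderHom j) : ℕ) = _
      rw [h2, h4]
      rfl

lemma degens_eq_map (X : SSet.{u}) {m : ℕ} (x : Simplex X m) : ∀ l : List ℕ, l.Pairwise (· > ·) →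
    (∀ i ∈ l, i < m + l.length) →
    ∃ θ : ⦋m + l.length⦌ ⟶ ⦋m⦌, degens X l x = X.map θ.op x ∧
      ∀ j : Fin (m + l.length + 1), (θ.toOrderHom j : ℕ) = degensFun l j
  | [], _, _ => ⟨𝟙 _, by simp [degens], fun j => rfl⟩
  | i :: l, hs, hl => by
    simp only [List.length_cons, List.mem_cons, forall_eq_or_imp, List.pairwise_cons] at hl hs
    obtain ⟨θ, h1, h2⟩ := degens_eq_map X x l hs.2
      (fun k hk => by have := hs.1 k hk; omega)
    obtain ⟨η, h3, h4⟩ := degen_eq_map X i (m + l.length) (by omega) (degens X l x)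
    refine ⟨η ≫ θ, ?_, fun j => ?_⟩
    · rw [op_comp, X.map_comp]
      change degen X i (degens X l x) = X.map η.op (X.map θ.op x)
      rw [h3, h1]
    · change (θ.toOrderHom (η.toOrderHom j) : ℕ) = _
      rw [h2, h4]
      rfl

lemma castDim_eq_map {X : SSet.{u}} {k m n : ℕ} (h : m = n) (x : Simplex X m) (a : Simplex X k)
    (θ : ⦋m⦌ ⟶ ⦋k⦌) (hx : x = X.map θ.op a) (f : ℕ → ℕ)
    (hθ : ∀ j : Fin (m + 1), (θ.toOrderHom j : ℕ) = f j) :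
    ∃ η : ⦋n⦌ ⟶ ⦋k⦌, castDim h x = X.map η.op a ∧
      ∀ j : Fin (n + 1), (η.toOrderHom j : ℕ) = f j := by
  subst h
  exact ⟨θ, hx, hθ⟩

lemma facesFun_consec (a r j : ℕ) :
    facesFun (List.range' a r) j = if j < a then j else j + r := by
  induction r generalizing a j with
  | zero => simp [facesFun]
  | succ r ih =>
    rw [List.range'_succ, facesFun, ih]
    unfold dFun
    split_ifs <;> omega

lemma degensFun_eq (l : List ℕ) (hl : l.Pairwise (· > ·)) (j : ℕ) :
    degensFun l j = j - l.countP (· < j) := by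
  induction l generalizing j with
  | nil => simp [degensFun]
  | cons i l ih =>
    rw [List.pairwise_cons] at hl
    rw [degensFun, ih hl.2, sFun, List.countP_cons]
    by_cases hj : j ≤ i
    · have : ¬ i < j := by omega
      simp [hj, this]
    · have e1 : l.countP (· < j - 1) = l.length :=
        List.countP_eq_length.2 fun k hk => by have := hl.1 k hk; simp; omega
      have e2 : l.countP (· < j) = l.length :=
        List.countP_eq_length.2 fun k hk => by have := hl.1 k hk; simp; omega
      simp only [hj, if_false, e1, e2]
      have : i < j := by omega
      simp [this]
      omega

/-! ### Degenerate simplices -/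

lemma factor_of_collapse {N k : ℕ} (θ : ⦋N + 1⦌ ⟶ ⦋k⦌) (j : ℕ) (hj : j < N + 1)
    (h : θ.toOrderHom (⟨j, by omega⟩ : Fin (N + 2)) =
      θ.toOrderHom (⟨j + 1, by omega⟩ : Fin (N + 2))) :
    θ = SimplexCategory.σ (⟨j, hj⟩ : Fin (N + 1)) ≫
      (SimplexCategory.δ (⟨j + 1, by omega⟩ : Fin (N + 2)) ≫ θ) := by
  apply SimplexCategory.Hom.ext
  ext t : 2
  change Fin (N + 2) at t
  change θ.toOrderHom t = θ.toOrderHom (Fin.succAbove (⟨j + 1, _⟩ : Fin (N + 2))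
    (Fin.predAbove (⟨j, _⟩ : Fin (N + 1)) t))
  by_cases ht : (t : ℕ) = j + 1
  · have e1 : t = ⟨j + 1, by omega⟩ := Fin.ext ht
    have e2 : Fin.succAbove (⟨j + 1, by omega⟩ : Fin (N + 2))
        (Fin.predAbove (⟨j, by omega⟩ : Fin (N + 1)) t) = ⟨j, by omega⟩ := by
      apply Fin.ext
      unfold Fin.succAbove Fin.predAbove
      simp only [Fin.lt_def, Fin.val_castSucc]
      split_ifs <;> first | omega | simp_all
    rw [e2, h, e1]
  · congr 1
    apply Fin.ext
    unfold Fin.succAbove Fin.predAbove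
    simp only [Fin.lt_def, Fin.val_castSucc]
    split_ifs <;> simp_all <;> omega

lemma map_of_collapse (X : SSet.{u}) {N k : ℕ} (θ : ⦋N + 1⦌ ⟶ ⦋k⦌) (a : Simplex X k)
    (j : ℕ) (hj : j < N + 1)
    (h : θ.toOrderHom (⟨j, by omega⟩ : Fin (N + 2)) =
      θ.toOrderHom (⟨j + 1, by omega⟩ : Fin (N + 2))) :
    X.map (SimplexCategory.σ (⟨j, hj⟩ : Fin (N + 1))).op
      (X.map (SimplexCategory.δ (⟨j + 1, by omega⟩ : Fin (N + 2)) ≫ θ).op a) = X.map θ.op a := by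
  conv_rhs => rw [factor_of_collapse θ j hj h, op_comp, X.map_comp]
  rfl

lemma mem_degenerate_of_collapse (X : SSet.{u}) {N k : ℕ} (θ : ⦋N⦌ ⟶ ⦋k⦌) (a : Simplex X k)
    (j : ℕ) (hj : j < N)
    (h : θ.toOrderHom (⟨j, by omega⟩ : Fin (N + 1)) =
      θ.toOrderHom (⟨j + 1, by omega⟩ : Fin (N + 1))) :
    X.map θ.op a ∈ X.degenerate N := by
  obtain _ | N := N
  · omega
  exact ⟨N, by omega, SimplexCategory.σ (⟨j, by omega⟩ : Fin (N + 1)), _,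
    map_of_collapse X θ a j hj h⟩

lemma pair_mem_degenerate (X Y : SSet.{u}) {N k : ℕ} (θ η : ⦋N⦌ ⟶ ⦋k⦌) (a : Simplex X k)
    (b : Simplex Y k) (j : ℕ) (hj : j < N)
    (h : θ.toOrderHom (⟨j, by omega⟩ : Fin (N + 1)) =
      θ.toOrderHom (⟨j + 1, by omega⟩ : Fin (N + 1)))
    (h' : η.toOrderHom (⟨j, by omega⟩ : Fin (N + 1)) =
      η.toOrderHom (⟨j + 1, by omega⟩ : Fin (N + 1))) :
    ((X.map θ.op a, Y.map η.op b) : Simplex (X ⊗ Y) N) ∈ (X ⊗ Y).degenerate N := by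
  obtain _ | N := N
  · omega
  refine ⟨N, by omega, SimplexCategory.σ (⟨j, by omega⟩ : Fin (N + 1)),
    ((X.map (SimplexCategory.δ (⟨j + 1, by omega⟩ : Fin (N + 2)) ≫ θ).op a,
      Y.map (SimplexCategory.δ (⟨j + 1, by omega⟩ : Fin (N + 2)) ≫ η).op b) :
      Simplex (X ⊗ Y) N), ?_⟩
  exact Prod.ext (map_of_collapse X θ a j hj h) (map_of_collapse Y η b j hj h')

lemma exists_collapse {m k : ℕ} (φ : ⦋m⦌ ⟶ ⦋k⦌) (hk : k < m) :
    ∃ i, ∃ hi : i < m, φ.toOrderHom (⟨i, by omega⟩ : Fin (m + 1)) =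
      φ.toOrderHom (⟨i + 1, by omega⟩ : Fin (m + 1)) := by
  by_contra! hne
  have hs : ∀ i (hi : i < m + 1), i ≤ (φ.toOrderHom (⟨i, hi⟩ : Fin (m + 1)) : Fin (k + 1)) := by
    intro i
    induction i with
    | zero => intro hi; omega
    | succ i ih =>
      intro hi
      have h1 := ih (by omega)
      have h2 : (φ.toOrderHom (⟨i, by omega⟩ : Fin (m + 1)) : Fin (k + 1)) <
          φ.toOrderHom (⟨i + 1, by omega⟩ : Fin (m + 1)) :=
        lt_of_le_of_ne (φ.toOrderHom.monotone (Fin.le_def.2 (by simp))) (hne i (by omega))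
      have h3 := Fin.lt_def.1 h2
      omega
  have h1 := hs m (by omega)
  have h2 : ((φ.toOrderHom (⟨m, by omega⟩ : Fin (m + 1)) : Fin (k + 1)) : ℕ) < k + 1 := Fin.is_lt _
  omega

/-! ### Normalized chains -/

/-- The module `C^N_n(X)` of normalized `n`-chains: the free `R`-module on the `n`-simplices of `X`
modulo the submodule spanned by the degenerate simplices. -/
abbrev NChain (R : Type v) [CommRing R] (X : SSet.{u}) (n : ℕ) : Type (max u v) :=
  (Simplex X n →₀ R) ⧸
    Submodule.span R ((fun x => Finsupp.single x (1 : R)) '' X.degenerate n)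

/-- The class of a simplex in the normalized chains. -/
def cls (R : Type v) [CommRing R] {X : SSet.{u}} {n : ℕ} (x : Simplex X n) : NChain R X n :=
  Submodule.Quotient.mk (Finsupp.single x 1)

lemma cls_eq_zero (R : Type v) [CommRing R] {X : SSet.{u}} {n : ℕ} {x : Simplex X n}
    (hx : x ∈ X.degenerate n) : cls R x = 0 :=
  (Submodule.Quotient.mk_eq_zero _).2 (Submodule.subset_span ⟨x, hx, rfl⟩)

/-- The linear map on normalized chains determined by a function on simplices that vanishes on
degenerate simplices. -/
def liftN (R : Type v) [CommRing R] {X : SSet.{u}} {n : ℕ} {M : Type*} [AddCommMonoid M]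
    [Module R M] (f : Simplex X n → M) (hf : ∀ x ∈ X.degenerate n, f x = 0) :
    NChain R X n →ₗ[R] M :=
  letI := Module.addCommMonoidToAddCommGroup R (M := M)
  Submodule.liftQ _ (Finsupp.linearCombination R f) (by
    rw [Submodule.span_le]
    rintro _ ⟨x, hx, rfl⟩
    simp [hf x hx])

@[simp]
lemma liftN_cls (R : Type v) [CommRing R] {X : SSet.{u}} {n : ℕ} {M : Type*} [AddCommMonoid M]
    [Module R M] (f : Simplex X n → M) (hf : ∀ x ∈ X.degenerate n, f x = 0) (x : Simplex X n) :
    liftN R f hf (cls R x) = f x := by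
  simp [liftN, cls]

/-- The degree `k` part `⨁_{p + q = k} C^N_p(X) ⊗ C^N_q(Y)` of the tensor product
`C^N_*(X) ⊗ C^N_*(Y)`. -/
abbrev TChain (R : Type v) [CommRing R] (X Y : SSet.{u}) (k : ℕ) : Type (max u v) :=
  DirectSum (Finset.HasAntidiagonal.antidiagonal k) fun pq => NChain R X pq.1.1 ⊗[R] NChain R Y pq.1.2

/-- The element `x ⊗ y` of degree `k = p + q` given by a `p`-simplex `x` and a `q`-simplex `y`. -/
def tcls (R : Type v) [CommRing R] {X Y : SSet.{u}} {p q k : ℕ} (h : p + q = k)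
    (x : Simplex X p) (y : Simplex Y q) : TChain R X Y k :=
  DirectSum.lof R (Finset.HasAntidiagonal.antidiagonal k)
    (fun pq => NChain R X pq.1.1 ⊗[R] NChain R Y pq.1.2)
    ⟨(p, q), Finset.HasAntidiagonal.mem_antidiagonal.2 h⟩ (cls R x ⊗ₜ[R] cls R y)

/-- The simplex `a × b` of the product `X × Y`. -/
def pair {X Y : SSet.{u}} {n : ℕ} (a : Simplex X n) (b : Simplex Y n) : Simplex (X ⊗ Y) n := (a, b)

/-! ### The operators -/

lemma faces_mem_degenerate {X : SSet.{u}} {k m : ℕ} (φ : ⦋m⦌ ⟶ ⦋k⦌) (a : Simplex X k)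
    (i : ℕ) (hi : i < m) (hφ : φ.toOrderHom (⟨i, by omega⟩ : Fin (m + 1)) =
      φ.toOrderHom (⟨i + 1, by omega⟩ : Fin (m + 1))) (l : List ℕ) (hl : l.length ≤ m)
    (j : ℕ) (hj : j < m - l.length) (h1 : facesFun l j = i) (h2 : facesFun l (j + 1) = i + 1) :
    faces X l (X.map φ.op a) ∈ X.degenerate (m - l.length) := by
  obtain ⟨θ, h3, h4⟩ := faces_eq_map X (X.map φ.op a) l hl
  have e : faces X l (X.map φ.op a) = X.map (θ ≫ φ).op a := by
    rw [h3, op_comp, X.map_comp]; rfl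
  rw [e]
  refine mem_degenerate_of_collapse X (θ ≫ φ) a j hj ?_
  have e1 : θ.toOrderHom (⟨j, by omega⟩ : Fin (m - l.length + 1)) =
    (⟨i, by omega⟩ : Fin (m + 1)) := Fin.ext ((h4 _).trans h1)
  have e2 : θ.toOrderHom (⟨j + 1, by omega⟩ : Fin (m - l.length + 1)) =
    (⟨i + 1, by omega⟩ : Fin (m + 1)) := Fin.ext ((h4 _).trans h2)
  change φ.toOrderHom (θ.toOrderHom _) = φ.toOrderHom (θ.toOrderHom _)
  rw [e1, e2, hφ]

lemma eq_map_of_mem_degenerate {X Y : SSet.{u}} {m : ℕ} {z : Simplex (X ⊗ Y) m}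
    (hz : z ∈ (X ⊗ Y).degenerate m) :
    ∃ (k : ℕ) (_ : k < m) (φ : ⦋m⦌ ⟶ ⦋k⦌) (a : Simplex X k) (b : Simplex Y k),
      z = pair (X.map φ.op a) (Y.map φ.op b) := by
  obtain ⟨k, hk, φ, w, rfl⟩ := hz
  exact ⟨k, hk, φ, Prod.fst w, Prod.snd w, rfl⟩

/-- The value of the Alexander-Whitney operator:
`AW(a × b) = ∑_{i=0}^m ∂_{i+1} ⋯ ∂_m a ⊗ ∂_0 ⋯ ∂_{i-1} b`. -/
def awVal (R : Type v) [CommRing R] {X Y : SSet.{u}} {m : ℕ} (a : Simplex X m)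
    (b : Simplex Y m) : TChain R X Y m :=
  ∑ i : Fin (m + 1), tcls R (by simp only [consec, List.length_range']; omega)
    (faces X (consec (i + 1) (m + 1)) a)
    (faces Y (consec 0 i) b)

lemma tcls_eq_zero_left (R : Type v) [CommRing R] {X Y : SSet.{u}} {p q k : ℕ} (h : p + q = k)
    {x : Simplex X p} (y : Simplex Y q) (hx : x ∈ X.degenerate p) : tcls R h x y = 0 := by
  rw [tcls, cls_eq_zero R hx, TensorProduct.zero_tmul, map_zero]

lemma tcls_eq_zero_right (R : Type v) [CommRing R] {X Y : SSet.{u}} {p q k : ℕ} (h : p + q = k)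
    (x : Simplex X p) {y : Simplex Y q} (hy : y ∈ Y.degenerate q) : tcls R h x y = 0 := by
  rw [tcls, cls_eq_zero R hy, TensorProduct.tmul_zero, map_zero]

lemma awVal_eq_zero (R : Type v) [CommRing R] {X Y : SSet.{u}} {m k : ℕ} (hk : k < m)
    (φ : ⦋m⦌ ⟶ ⦋k⦌) (a : Simplex X k) (b : Simplex Y k) :
    awVal R (X.map φ.op a) (Y.map φ.op b) = 0 := by
  obtain ⟨i, hi, hφ⟩ := exists_collapse φ hk
  refine Finset.sum_eq_zero fun t _ => ?_
  have ht := t.2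
  by_cases hit : i < t
  · refine tcls_eq_zero_left R _ _ (faces_mem_degenerate φ a i hi hφ _ ?_ i ?_ ?_ ?_)
    · simp [consec]
    · simp [consec]; omega
    · rw [consec, facesFun_consec]; split_ifs <;> omega
    · rw [consec, facesFun_consec]; split_ifs <;> omega
  · refine tcls_eq_zero_right R _ _ (faces_mem_degenerate φ b i hi hφ _ ?_ (i - t) ?_ ?_ ?_)
    · simp [consec]; omega
    · simp [consec]; omega
    · rw [consec, facesFun_consec]; split_ifs <;> omega
    · rw [consec, facesFun_consec]; split_ifs <;> omega

/-- The Alexander-Whitney operator. -/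
def AW (R : Type v) [CommRing R] (X Y : SSet.{u}) (m : ℕ) :
    NChain R (X ⊗ Y) m →ₗ[R] TChain R X Y m :=
  liftN R (X := X ⊗ Y) (M := TChain R X Y m) (fun z => awVal R (Prod.fst z) (Prod.snd z)) (by
    intro z hz
    obtain ⟨k, hk, φ, a, b, rfl⟩ := eq_map_of_mem_degenerate hz
    exact awVal_eq_zero R hk φ a b)

/-- The automorphism `t(a × b) = b × a`. -/
def swap (R : Type v) [CommRing R] (X : SSet.{u}) (m : ℕ) :
    NChain R (X ⊗ X) m →ₗ[R] NChain R (X ⊗ X) m :=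
  liftN R (X := X ⊗ X) (fun z => cls R (pair (Prod.snd z) (Prod.fst z))) (by
    rintro _ ⟨k, hk, φ, w, rfl⟩
    exact cls_eq_zero R ⟨k, hk, φ, pair (Prod.snd w) (Prod.fst w), rfl⟩)

/-- A `(p, q)`-shuffle `(α, β)`, given by the set `α ⊆ {0, …, p + q - 1}` of cardinality `p`. -/
abbrev Shuffle (p q : ℕ) : Type :=
  {α : Finset ℕ // α ∈ (Finset.range (p + q)).powersetCard p}

/-- The set `β`, complementary to `α`. -/
def Shuffle.compl {p q : ℕ} (S : Shuffle p q) : Finset ℕ := Finset.range (p + q) \ S.1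

/-- The list `α_p, …, α_1`, in decreasing order. -/
def Shuffle.alphas {p q : ℕ} (S : Shuffle p q) : List ℕ := S.1.sort (· ≥ ·)

/-- The list `β_q, …, β_1`, in decreasing order. -/
def Shuffle.betas {p q : ℕ} (S : Shuffle p q) : List ℕ := S.compl.sort (· ≥ ·)

/-- The signature `∑_{i=1}^p (α_i - (i - 1))`; every summand is a natural number, and so is the
difference below. -/
def Shuffle.sig {p q : ℕ} (S : Shuffle p q) : ℕ :=
  (∑ x ∈ S.1, x) - ∑ i ∈ Finset.range p, i

lemma Shuffle.card_alpha {p q : ℕ} (S : Shuffle p q) : S.1.card = p :=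
  (Finset.mem_powersetCard.1 S.2).2

lemma Shuffle.card_compl {p q : ℕ} (S : Shuffle p q) : S.compl.card = q := by
  rw [Shuffle.compl, Finset.card_sdiff_of_subset (Finset.mem_powersetCard.1 S.2).1, S.card_alpha,
    Finset.card_range]
  omega

/-- The factor `s_{β_q+m̄} ⋯ s_{β_1+m̄} s_{m̄-1} ∂_{m-q+1} ⋯ ∂_m a`, for `m̄ = m - p - q`. -/
def shiFst (X : SSet.{u}) {m : ℕ} (p q : ℕ) (h : p + q < m) (S : Shuffle (p + 1) q)
    (a : Simplex X m) : Simplex X (m + 1) :=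
  castDim (by simp [consec, Shuffle.betas, S.card_compl]; omega)
    (degens X (S.betas.map (· + (m - p - q)) ++ [m - p - q - 1])
      (faces X (consec (m - q + 1) (m + 1)) a))

/-- The factor `s_{α_{p+1}+m̄} ⋯ s_{α_1+m̄} ∂_{m̄} ⋯ ∂_{m-q-1} b`, for `m̄ = m - p - q`. -/
def shiSnd (Y : SSet.{u}) {m : ℕ} (p q : ℕ) (h : p + q < m) (S : Shuffle (p + 1) q)
    (b : Simplex Y m) : Simplex Y (m + 1) :=
  castDim (by simp [consec, Shuffle.alphas, S.card_alpha]; omega)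
    (degens Y (S.alphas.map (· + (m - p - q))) (faces Y (consec (m - p - q) (m - q)) b))

lemma countP_sort (A : Finset ℕ) (c j : ℕ) :
    ((A.sort (· ≥ ·)).map (· + c)).countP (· < j) = (A.filter (· + c < j)).card := by
  rw [List.countP_map, ← Finset.length_sort (· ≥ ·) (s := A.filter (· + c < j)), List.countP_eq_length_filter]
  have : (A.sort (· ≥ ·)).filter ((fun x => decide (x < j)) ∘ fun x => x + c) =
      (A.sort (· ≥ ·)).filter fun x => decide (x + c < j) := rfl
  rw [this]
  rw [← Multiset.coe_card, ← Multiset.coe_card, Finset.sort_eq, ← Multiset.filter_coe, Finset.sort_eq]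
  rfl

lemma pairwise_sort (A : Finset ℕ) (c : ℕ) :
    ((A.sort (· ≥ ·)).map (· + c)).Pairwise (· > ·) := by
  rw [List.pairwise_map]
  exact (Finset.sortedGT_sort A).pairwise.imp (by intros; omega)

/-- The number of elements of `A` below `t`. -/
def below (A : Finset ℕ) (t : ℕ) : ℕ := (A.filter (· < t)).card

lemma below_succ (A : Finset ℕ) (t : ℕ) : below A (t + 1) = below A t + if t ∈ A then 1 else 0 := by
  have e : A.filter (· < t + 1) = A.filter (· < t) ∪ A.filter (· = t) := by
    ext x; by_cases hx : x ∈ A <;> simp [hx]; omega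
  rw [below, below, e, Finset.card_union_of_disjoint]
  · congr 1
    rw [Finset.filter_eq']
    split_ifs <;> simp
  · rw [Finset.disjoint_left]
    intro x; simp only [Finset.mem_filter]; omega

lemma exists_below (A : Finset ℕ) (c : ℕ) (hc : c < A.card) : ∃ t ∈ A, below A t = c := by
  have hex : ∃ t, c < below A (t + 1) := by
    refine ⟨A.sup id, ?_⟩
    rw [below, Finset.filter_true_of_mem]
    · exact hc
    · intro x hx
      have := Finset.le_sup (f := id) hx
      simp only [id] at this
      omega
  classical
  have h1 := Nat.find_spec hex
  have h2 := fun t => Nat.find_min hex (m := t)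
  set t := Nat.find hex
  have h3 : below A t ≤ c := by
    rcases ht : t with _ | s
    · simp [below]
    · have := h2 s (by omega)
      omega
  rw [below_succ] at h1
  refine ⟨t, ?_, ?_⟩
  · by_contra hn
    simp [hn] at h1
    omega
  · split_ifs at h1 <;> omega

lemma below_add_compl {p q : ℕ} (S : Shuffle p q) (t : ℕ) (ht : t ≤ p + q) :
    below S.1 t + below S.compl t = t := by
  induction t with
  | zero => simp [below]
  | succ t ih =>
    rw [below_succ, below_succ]
    have := ih (by omega)
    have h : t ∈ S.compl ↔ t ∉ S.1 := by
      simp [Shuffle.compl]; omega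
    by_cases h' : t ∈ S.1 <;> simp [h, h'] <;> omega

lemma below_le (A : Finset ℕ) (t : ℕ) : below A t ≤ A.card := Finset.card_filter_le _ _

lemma card_filter_add (A : Finset ℕ) (c j : ℕ) :
    (A.filter (· + c < j)).card = below A (j - c) := by
  rw [below]
  congr 1
  ext x
  by_cases hx : x ∈ A <;> simp [hx]
  omega

lemma degens_faces_eq_map (X : SSet.{u}) {m r N : ℕ} (L l : List ℕ) (hl : l.length = r)
    (hr : r ≤ m) (hL : L.Pairwise (· > ·)) (hb : ∀ i ∈ L, i < m - r + L.length)
    (h : m - l.length + L.length = N) (a : Simplex X m) :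
    ∃ θ : ⦋N⦌ ⟶ ⦋m⦌, castDim h (degens X L (faces X l a)) = X.map θ.op a ∧
      ∀ j : Fin (N + 1), (θ.toOrderHom j : ℕ) = facesFun l (degensFun L j) := by
  subst hl
  obtain ⟨θ, h1, h2⟩ := faces_eq_map X a l hr
  obtain ⟨η, h3, h4⟩ := degens_eq_map X (faces X l a) L hL hb
  refine castDim_eq_map h _ a (η ≫ θ) ?_ (fun j => facesFun l (degensFun L j)) fun j => ?_
  · rw [h3, h1, op_comp, X.map_comp]; rfl
  · change (θ.toOrderHom (η.toOrderHom j) : ℕ) = _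
    rw [h2, h4]

lemma shiFst_eq_map (X : SSet.{u}) {m : ℕ} (p q : ℕ) (h : p + q < m) (S : Shuffle (p + 1) q)
    (a : Simplex X m) :
    ∃ θ : ⦋m + 1⦌ ⟶ ⦋m⦌, shiFst X p q h S a = X.map θ.op a ∧
      ∀ j : Fin (m + 2), (θ.toOrderHom j : ℕ) =
        if (j : ℕ) < m - p - q then (j : ℕ)
        else m - p - q - 1 + below S.1 (j - (m - p - q)) := by
  have hL : (S.betas.map (· + (m - p - q)) ++ [m - p - q - 1]).Pairwise (· > ·) := by
    rw [List.pairwise_append]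
    refine ⟨pairwise_sort _ _, by simp, ?_⟩
    simp only [List.mem_map, List.mem_singleton]
    rintro _ ⟨x, _, rfl⟩ y rfl
    omega
  obtain ⟨θ, h1, h2⟩ := degens_faces_eq_map X (r := q) (N := m + 1)
    (S.betas.map (· + (m - p - q)) ++ [m - p - q - 1])
    (consec (m - q + 1) (m + 1)) (by simp [consec]; omega) (by omega) hL (by
      have hlen : (S.betas.map (· + (m - p - q)) ++ [m - p - q - 1]).length = q + 1 := by
        simp [Shuffle.betas, S.card_compl]
      intro i hi
      rw [hlen]
      simp only [List.mem_append, List.mem_map, List.mem_singleton, Shuffle.betas,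
        Finset.mem_sort] at hi
      rcases hi with ⟨x, hx, rfl⟩ | rfl
      · have := Finset.mem_range.1 (Finset.sdiff_subset hx)
        omega
      · omega)
    (by simp [consec, Shuffle.betas, S.card_compl]; omega) a
  refine ⟨θ, h1, fun j => ?_⟩
  rw [h2, degensFun_eq _ hL, List.countP_append]
  rw [Shuffle.betas, countP_sort, card_filter_add, consec, facesFun_consec]
  have hj := j.2
  by_cases hjm : (j : ℕ) < m - p - q
  · have e1 : (j : ℕ) - (m - p - q) = 0 := by omega
    have e2 : ¬ m - p - q - 1 < (j : ℕ) := by omega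
    rw [e1]
    simp [below, hjm, e2]
    omega
  · have e1 := below_add_compl S (j - (m - p - q)) (by omega)
    have e2 : m - p - q - 1 < (j : ℕ) := by omega
    have e3 := below_le S.1 (j - (m - p - q))
    rw [S.card_alpha] at e3
    simp only [List.countP_cons, List.countP_nil, e2, decide_true, if_true, hjm, if_false]
    split_ifs <;> omega

lemma shiSnd_eq_map (Y : SSet.{u}) {m : ℕ} (p q : ℕ) (h : p + q < m) (S : Shuffle (p + 1) q)
    (b : Simplex Y m) :
    ∃ θ : ⦋m + 1⦌ ⟶ ⦋m⦌, shiSnd Y p q h S b = Y.map θ.op b ∧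
      ∀ j : Fin (m + 2), (θ.toOrderHom j : ℕ) =
        if (j : ℕ) < m - p - q then (j : ℕ)
        else m - q + below S.compl (j - (m - p - q)) := by
  have hL : (S.alphas.map (· + (m - p - q))).Pairwise (· > ·) := pairwise_sort _ _
  obtain ⟨θ, h1, h2⟩ := degens_faces_eq_map Y (r := p) (N := m + 1)
    (S.alphas.map (· + (m - p - q)))
    (consec (m - p - q) (m - q)) (by simp [consec]; omega) (by omega) hL (by
      have hlen : (S.alphas.map (· + (m - p - q))).length = p + 1 := by
        simp [Shuffle.alphas, S.card_alpha]
      intro i hi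
      rw [hlen]
      simp only [List.mem_map, Shuffle.alphas, Finset.mem_sort] at hi
      obtain ⟨x, hx, rfl⟩ := hi
      have := Finset.mem_range.1 ((Finset.mem_powersetCard.1 S.2).1 hx)
      omega)
    (by simp [consec, Shuffle.alphas, S.card_alpha]; omega) b
  refine ⟨θ, h1, fun j => ?_⟩
  rw [h2, degensFun_eq _ hL]
  rw [Shuffle.alphas, countP_sort, card_filter_add, consec, facesFun_consec]
  have hj := j.2
  by_cases hjm : (j : ℕ) < m - p - q
  · have e1 : (j : ℕ) - (m - p - q) = 0 := by omega
    rw [e1]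
    simp [below, hjm]
  · have e1 := below_add_compl S (j - (m - p - q)) (by omega)
    simp only [hjm, if_false]
    split_ifs <;> omega

lemma shi_mem_degenerate {X Y : SSet.{u}} {m k : ℕ} (hk : k < m) (φ : ⦋m⦌ ⟶ ⦋k⦌)
    (a : Simplex X k) (b : Simplex Y k) (p q : ℕ) (h : p + q < m) (S : Shuffle (p + 1) q) :
    pair (shiFst X p q h S (X.map φ.op a)) (shiSnd Y p q h S (Y.map φ.op b)) ∈
      (X ⊗ Y).degenerate (m + 1) := by
  obtain ⟨i, hi, hφ⟩ := exists_collapse φ hk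
  obtain ⟨θ, h1, h2⟩ := shiFst_eq_map X p q h S (X.map φ.op a)
  obtain ⟨η, h3, h4⟩ := shiSnd_eq_map Y p q h S (Y.map φ.op b)
  let f : ℕ → ℕ := fun j => if j < m - p - q then j
    else m - p - q - 1 + below S.1 (j - (m - p - q))
  let g : ℕ → ℕ := fun j => if j < m - p - q then j
    else m - q + below S.compl (j - (m - p - q))
  have key : ∃ j, ∃ _ : j < m + 1, (f j = f (j + 1) ∨ (f j = i ∧ f (j + 1) = i + 1)) ∧
      (g j = g (j + 1) ∨ (g j = i ∧ g (j + 1) = i + 1)) := by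
    have hS : ∀ t, t < p + 1 + q → (t ∈ S.compl ↔ t ∉ S.1) := by
      intro t ht; simp [Shuffle.compl, ht]
    have hA : ∀ t ∈ S.1, t < p + 1 + q := fun t ht =>
      Finset.mem_range.1 ((Finset.mem_powersetCard.1 S.2).1 ht)
    have hB : ∀ t ∈ S.compl, t < p + 1 + q := fun t ht =>
      Finset.mem_range.1 (Finset.sdiff_subset ht)
    have step : ∀ t, f (m - p - q + t) = m - p - q - 1 + below S.1 t ∧
        g (m - p - q + t) = m - q + below S.compl t := by
      intro t
      simp [f, g]
    by_cases h5 : i < m - p - q - 1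
    · have h6 : i < m - p - q := by omega
      have h7 : i + 1 < m - p - q := by omega
      refine ⟨i, by omega, Or.inr ?_, Or.inr ?_⟩ <;> simp [f, g, h6, h7]
    by_cases h6 : i < m - q
    · obtain ⟨t, ht, e⟩ := exists_below S.1 (i - (m - p - q - 1)) (by
        rw [S.card_alpha]; omega)
      have ht' := hA t ht
      have hc : t ∉ S.compl := fun hc => (hS t ht').1 hc ht
      refine ⟨m - p - q + t, by omega, Or.inr ?_, Or.inl ?_⟩
      · rw [add_assoc, (step _).1, (step _).1, below_succ, if_pos ht]
        omega
      · rw [add_assoc, (step _).2, (step _).2, below_succ, if_neg hc]; rfl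
    · obtain ⟨t, ht, e⟩ := exists_below S.compl (i - (m - q)) (by
        rw [S.card_compl]; omega)
      have ht' := hB t ht
      have hc : t ∉ S.1 := (hS t ht').1 ht
      refine ⟨m - p - q + t, by omega, Or.inl ?_, Or.inr ?_⟩
      · rw [add_assoc, (step _).1, (step _).1, below_succ, if_neg hc]; rfl
      · rw [add_assoc, (step _).2, (step _).2, below_succ, if_pos ht]
        omega
  obtain ⟨j, hj, hθ, hη⟩ := key
  have e : pair (shiFst X p q h S (X.map φ.op a)) (shiSnd Y p q h S (Y.map φ.op b)) =
      pair (X.map (θ ≫ φ).op a) (Y.map (η ≫ φ).op b) := by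
    rw [h1, h3, op_comp, op_comp, X.map_comp, Y.map_comp]; rfl
  rw [e]
  refine pair_mem_degenerate X Y (θ ≫ φ) (η ≫ φ) a b j hj ?_ ?_
  · change φ.toOrderHom (θ.toOrderHom _) = φ.toOrderHom (θ.toOrderHom _)
    rcases hθ with hθ | ⟨e1, e2⟩
    · exact congrArg φ.toOrderHom (Fin.ext ((h2 _).trans (hθ.trans (h2 ⟨j + 1, by omega⟩).symm)))
    · have e1' : θ.toOrderHom (⟨j, by omega⟩ : Fin (m + 2)) = (⟨i, by omega⟩ : Fin (m + 1)) :=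
        Fin.ext ((h2 _).trans e1)
      have e2' : θ.toOrderHom (⟨j + 1, by omega⟩ : Fin (m + 2)) =
        (⟨i + 1, by omega⟩ : Fin (m + 1)) := Fin.ext ((h2 _).trans e2)
      rw [e1', e2', hφ]
  · change φ.toOrderHom (η.toOrderHom _) = φ.toOrderHom (η.toOrderHom _)
    rcases hη with hη | ⟨e1, e2⟩
    · exact congrArg φ.toOrderHom (Fin.ext ((h4 _).trans (hη.trans (h4 ⟨j + 1, by omega⟩).symm)))
    · have e1' : η.toOrderHom (⟨j, by omega⟩ : Fin (m + 2)) = (⟨i, by omega⟩ : Fin (m + 1)) :=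
        Fin.ext ((h4 _).trans e1)
      have e2' : η.toOrderHom (⟨j + 1, by omega⟩ : Fin (m + 2)) =
        (⟨i + 1, by omega⟩ : Fin (m + 1)) := Fin.ext ((h4 _).trans e2)
      rw [e1', e2', hφ]

/-- The value of the Shih operator: the sum, over all `0 ≤ q ≤ m - 1`, `0 ≤ p ≤ m - q - 1` and all
`(p + 1, q)`-shuffles `(α, β)`, with `m̄ = m - p - q`, of `(-1)^{m̄ + sig(α, β) + 1}` times
`s_{β_q+m̄} ⋯ s_{β_1+m̄} s_{m̄-1} ∂_{m-q+1} ⋯ ∂_m a ×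
s_{α_{p+1}+m̄} ⋯ s_{α_1+m̄} ∂_{m̄} ⋯ ∂_{m-q-1} b`. It is zero for `m = 0`. -/
def shiVal (R : Type v) [CommRing R] {X Y : SSet.{u}} {m : ℕ} (a : Simplex X m)
    (b : Simplex Y m) : NChain R (X ⊗ Y) (m + 1) :=
  ∑ q : Fin m, ∑ p : Fin (m - q), ∑ S : Shuffle (p + 1) q,
    ((-1 : R) ^ (m - p - q + S.sig + 1)) •
      cls R (pair (shiFst X p q (by omega) S a) (shiSnd Y p q (by omega) S b))

/-- The Shih operator. -/
def SHI (R : Type v) [CommRing R] (X Y : SSet.{u}) (m : ℕ) :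
    NChain R (X ⊗ Y) m →ₗ[R] NChain R (X ⊗ Y) (m + 1) :=
  liftN R (X := X ⊗ Y) (fun z => shiVal R (Prod.fst z) (Prod.snd z)) (by
    intro z hz
    obtain ⟨k, hk, φ, a, b, rfl⟩ := eq_map_of_mem_degenerate hz
    refine Finset.sum_eq_zero fun q _ => Finset.sum_eq_zero fun p _ =>
      Finset.sum_eq_zero fun S _ => ?_
    have h0 := cls_eq_zero R (shi_mem_degenerate hk φ a b p q (by omega) S)
    exact (congrArg _ h0).trans (smul_zero _))

/-- The power `(t SHI)^n`, on normalized `m`-chains of `X × X`. -/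
def tSHIpow (R : Type v) [CommRing R] (X : SSet.{u}) (m : ℕ) :
    (n : ℕ) → NChain R (X ⊗ X) m →ₗ[R] NChain R (X ⊗ X) (m + n)
  | 0 => LinearMap.id
  | n + 1 => (swap R X (m + n + 1) ∘ₗ SHI R X X (m + n)) ∘ₗ tSHIpow R X m n

/-- The map `h_n = AW (t SHI)^n : C^N_m(X × X) → (C^N_*(X) ⊗ C^N_*(X))_{m + n}`. -/
def hMap (R : Type v) [CommRing R] (X : SSet.{u}) (n m : ℕ) :
    NChain R (X ⊗ X) m →ₗ[R] TChain R X X (m + n) :=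
  AW R X X (m + n) ∘ₗ tSHIpow R X m n

/-! ### The explicit formula -/

/-- The range of summation: `n ≤ i_n ≤ m` and `k ≤ i_k ≤ i_{k+1} - 1` for `0 ≤ k < n`. -/
def indices (n m : ℕ) : Finset (Fin (n + 1) → ℕ) :=
  (Fintype.piFinset fun k : Fin (n + 1) => Finset.Icc (k : ℕ) m).filter
    fun i => ∀ k : Fin n, i k.castSucc < i k.succ

/-- The extension of `(i_0, …, i_n)` by the convention `i_{n+1} = m + 1`. -/
def extIdx {n : ℕ} (m : ℕ) (i : Fin (n + 1) → ℕ) (k : ℕ) : ℕ :=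
  if hk : k < n + 1 then i ⟨k, hk⟩ else m + 1

/-- The indices of the faces in the block `∂_{i_k+1} ⋯ ∂_{i_{k+1}-1}`. For `k = n` it is the block
`∂_{i_n+1} ⋯ ∂_m`. -/
def block {n : ℕ} (m : ℕ) (i : Fin (n + 1) → ℕ) (k : ℕ) : List ℕ :=
  consec (extIdx m i k + 1) (extIdx m i (k + 1))

/-- The face indices in the first tensor factor: the blocks with `k = 0, 2, 4, … ≤ n`. -/
def leftFaces {n : ℕ} (m : ℕ) (i : Fin (n + 1) → ℕ) : List ℕ :=
  ((List.range (n + 1)).filter fun k => Even k).flatMap (block m i)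

/-- The face indices in the second tensor factor: `∂_0 ⋯ ∂_{i_0-1}`, followed by the blocks with
`k = 1, 3, 5, … ≤ n`. -/
def rightFaces {n : ℕ} (m : ℕ) (i : Fin (n + 1) → ℕ) : List ℕ :=
  consec 0 (extIdx m i 0) ++ ((List.range (n + 1)).filter fun k => ¬ Even k).flatMap (block m i)

/-- The term `A(n)` of the sign exponent. -/
def signA (n : ℕ) : ℕ := if n % 8 = 3 ∨ n % 8 = 4 ∨ n % 8 = 5 ∨ n % 8 = 6 then 1 else 0

/-- The term `B(n, m, i)` of the sign exponent. The upper summation bound `⌊(n - 1) / 2⌋` is `-1`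
for `n = 0`. -/
def signB (n m : ℕ) (i : ℕ → ℕ) : ℕ :=
  if n % 4 = 1 ∨ n % 4 = 2 then ∑ j ∈ Finset.range (n / 2 + 1), i (2 * j)
  else (∑ j ∈ Finset.range ((n + 1) / 2), i (2 * j + 1)) + n * m

/-- The term `C(n, i)` of the sign exponent. -/
def signC (n : ℕ) (i : ℕ → ℕ) : ℕ :=
  ∑ j ∈ Finset.Icc 1 (n / 2), (i (2 * j) + i (2 * j - 1)) * ∑ l ∈ Finset.range (2 * j), i l

/-- The term `D(n, m, i)` of the sign exponent. -/
def signD (n m : ℕ) (i : ℕ → ℕ) : ℕ :=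
  if Odd n then (m + i n) * ∑ l ∈ Finset.range (n + 1), i l else 0

/-- The exponent `A + B + C + D` of the sign. -/
def signExp {n : ℕ} (m : ℕ) (i : Fin (n + 1) → ℕ) : ℕ :=
  signA n + signB n m (extIdx m i) + signC n (extIdx m i) + signD n m (extIdx m i)

lemma length_filter_flatMap (f : ℕ → List ℕ) (l : List ℕ) :
    ((l.filter fun k => Even k).flatMap f).length +
      ((l.filter fun k => ¬ Even k).flatMap f).length = (l.map fun k => (f k).length).sum := by
  induction l with
  | nil => simp
  | cons a l ih =>
    by_cases ha : Even a
    · simp only [List.filter_cons, ha, decide_true, not_true_eq_false, decide_false, if_true,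
        List.flatMap_cons, List.length_append, List.map_cons, List.sum_cons] at ih ⊢
      simp only [Bool.false_eq_true, if_false]
      omega
    · simp only [List.filter_cons, ha, decide_true, not_false_eq_true, decide_false, if_true,
        List.flatMap_cons, List.length_append, List.map_cons, List.sum_cons] at ih ⊢
      simp only [Bool.false_eq_true, if_false]
      omega

lemma sum_block_length {n m : ℕ} (i : Fin (n + 1) → ℕ) (hi : i ∈ indices n m) (t : ℕ)
    (ht : t ≤ n + 1) :
    extIdx m i 0 + ((List.range t).map fun k => (block m i k).length).sum + t = extIdx m i t := by
  have hlt : ∀ k < n + 1, extIdx m i k < extIdx m i (k + 1) := by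
    intro k hk
    simp only [indices, Finset.mem_filter, Fintype.mem_piFinset, Finset.mem_Icc] at hi
    by_cases hk' : k < n
    · have := hi.2 ⟨k, hk'⟩
      simpa [extIdx, hk, hk'] using this
    · obtain rfl : k = n := by omega
      have := (hi.1 ⟨k, hk⟩).2
      simp [extIdx]
      omega
  induction t with
  | zero => simp
  | succ t ih =>
    have h1 := ih (by omega)
    have h2 := hlt t (by omega)
    have h3 : (block m i t).length = extIdx m i (t + 1) - (extIdx m i t + 1) := by simp [block, consec]
    rw [List.range_succ, List.map_append, List.sum_append]
    simp only [List.map_cons, List.map_nil, List.sum_cons, List.sum_nil, h3]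
    omega

/-- The degrees of the two tensor factors add up to `m + n`. -/
lemma degree_eq {n m : ℕ} (i : indices n m) :
    (m - (leftFaces m i.1).length) + (m - (rightFaces m i.1).length) = m + n := by
  have h1 := sum_block_length i.1 i.2 (n + 1) le_rfl
  have h2 := length_filter_flatMap (block m i.1) (List.range (n + 1))
  have h3 : extIdx m i.1 (n + 1) = m + 1 := by simp [extIdx]
  have h4 : (leftFaces m i.1).length + (rightFaces m i.1).length =
      extIdx m i.1 0 + ((List.range (n + 1)).map fun k => (block m i.1 k).length).sum := by
    rw [← h2]
    simp only [leftFaces, rightFaces, List.length_append, consec, List.length_range']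
    omega
  omega

end

end EilenbergZilber

namespace EilenbergZilber

open CategoryTheory TensorProduct MonoidalCategory

local notation "⦋" n "⦌" => SimplexCategory.mk n

/-! Induction on `n` through `h_{n+1} = h_n ∘ (t SHI)`: the innermost factor is peeled off, and the
formula for `h_n` in degree `m + 1` is applied to each summand of `t SHI(a × b)`. A term of `h_n`
with indices `e` restricts its two arguments to the vertex sets `(vertexSets e (n + 1)).1` and `.2`,
whatever tensor factor they land in. The summand of `SHI` for `p`, `q` and a shuffle pulls `a` and
`b` back along explicit monotone maps `θ` and `η`. So everything reduces to how these two maps act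
on the two vertex sets.

If `θ` or `η` identifies two retained vertices, the face is degenerate and the term vanishes. Write
`r = m - p - q`. Injectivity on both sets leaves only the shuffle with `β = {0, …, q - 1}` before `α
= {q, …, p + q}`, and forces `e_n = r + q` and `e_k < r - 1` for `k < n` (`shuffle_eq_last`,
`shi_hTerm_ne_zero`). In the surviving case the composite is a genuine face: it is the term of
`h_{n+1}` with indices `e_0, …, e_{n-1}, r - 1, m - q` (`castDeg_shi_hTerm`). All degeneracies have
cancelled, so only face operators remain.

Conversely, an index tuple for `h_{n+1}` determines `q`, then `p`, then `e`, so each of its terms is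
hit exactly once (`IndexRel`, `sum_shuffle_hTerm`). The surviving shuffle has signature `q(p + 1)`,
and the sign formula satisfies the resulting recursion modulo 2 (`sign_succ_even`, `sign_succ_odd`).
-/

/-! ### Faces of a simplex described by their vertex sets -/

/-- `y` is the face of `x` spanned by the vertices of `x` with index in `V`. -/
def IsFaceOn {X : SSet.{u}} {m N : ℕ} (x : Simplex X m) (V : Set ℕ) (y : Simplex X N) : Prop :=
  ∃ θ : ⦋N⦌ ⟶ ⦋m⦌, StrictMono θ.toOrderHom ∧
    (∀ v : Fin (m + 1), (v : ℕ) ∈ V ↔ ∃ j : Fin (N + 1), θ.toOrderHom j = v) ∧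
    y = X.map θ.op x

/-- A strictly monotone map out of an ordinal is determined by its range, and so is the size of its
source. Different strings of face operators can thus be compared through vertex sets alone,
including their dimensions. -/
lemma IsFaceOn.unique {X : SSet.{u}} {m N N' : ℕ} {x : Simplex X m} {V : Set ℕ} {y : Simplex X N}
    {y' : Simplex X N'} (h : IsFaceOn x V y) (h' : IsFaceOn x V y') :
    ∃ e : N = N', castDim e y = y' := by
  obtain ⟨θ, h1, h2, rfl⟩ := h
  obtain ⟨θ', h1', h2', rfl⟩ := h'
  have hr : Set.range θ.toOrderHom = Set.range θ'.toOrderHom := by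
    ext v
    exact (h2 v).symm.trans (h2' v)
  have hN : N = N' := by
    have := Fintype.card_congr ((Equiv.ofInjective _ h1.injective).trans
      ((Equiv.setCongr hr).trans (Equiv.ofInjective _ h1'.injective).symm))
    simpa using this
  subst hN
  refine ⟨rfl, ?_⟩
  have e : θ = θ' := by
    apply SimplexCategory.Hom.ext
    exact DFunLike.coe_injective ((StrictMono.range_inj h1 h1').1 hr)
  rw [e]
  rfl

/-- Where `G` is injective on the retained vertices, the degeneracies in `G` are undone by the face
operators, and what is left is the inclusion of the image of `V`. -/
lemma IsFaceOn.of_map {X : SSet.{u}} {M m N : ℕ} (G : ⦋M⦌ ⟶ ⦋m⦌) {x : Simplex X m} {V W : Set ℕ}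
    {y : Simplex X N} (h : IsFaceOn (X.map G.op x) V y)
    (hG : ∀ u v : Fin (M + 1), (u : ℕ) ∈ V → (v : ℕ) ∈ V → u < v →
      G.toOrderHom u < G.toOrderHom v)
    (hW : ∀ w : Fin (m + 1), (w : ℕ) ∈ W ↔ ∃ v : Fin (M + 1), (v : ℕ) ∈ V ∧ G.toOrderHom v = w) :
    IsFaceOn x W y := by
  obtain ⟨θ, h1, h2, rfl⟩ := h
  refine ⟨θ ≫ G, fun i j hij => hG _ _ ((h2 _).2 ⟨i, rfl⟩) ((h2 _).2 ⟨j, rfl⟩) (h1 hij),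
    fun w => (hW w).trans ⟨?_, ?_⟩, ?_⟩
  · rintro ⟨v, hv, rfl⟩
    obtain ⟨j, rfl⟩ := (h2 v).1 hv
    exact ⟨j, rfl⟩
  · rintro ⟨j, rfl⟩
    exact ⟨θ.toOrderHom j, (h2 _).2 ⟨j, rfl⟩, rfl⟩
  · rw [op_comp, X.map_comp]
    rfl

lemma IsFaceOn.mem_degenerate {X : SSet.{u}} {M m N : ℕ} (G : ⦋M⦌ ⟶ ⦋m⦌) {x : Simplex X m}
    {V : Set ℕ} {y : Simplex X N} (h : IsFaceOn (X.map G.op x) V y) (u v : Fin (M + 1))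
    (hu : (u : ℕ) ∈ V) (hv : (v : ℕ) ∈ V) (huv : u < v)
    (he : G.toOrderHom u = G.toOrderHom v) : y ∈ X.degenerate N := by
  obtain ⟨θ, h1, h2, rfl⟩ := h
  obtain ⟨i, rfl⟩ := (h2 u).1 hu
  obtain ⟨j, rfl⟩ := (h2 v).1 hv
  have hij : i < j := h1.lt_iff_lt.1 huv
  have hj := j.2
  have hij' := Fin.lt_def.1 hij
  have e : X.map θ.op (X.map G.op x) = X.map (θ ≫ G).op x := by
    rw [op_comp, X.map_comp]; rfl
  rw [e]
  -- By monotonicity every vertex between `i` and `j` has the same image, in particular the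
  -- neighbour `i + 1`.
  refine mem_degenerate_of_collapse X (θ ≫ G) x i (by omega) (le_antisymm ?_ ?_)
  · exact (θ ≫ G).toOrderHom.monotone (Fin.le_def.2 (by simp))
  · refine ((θ ≫ G).toOrderHom.monotone (Fin.le_def.2 (?_ : (i : ℕ) + 1 ≤ j))).trans he.ge
    omega

lemma facesFun_strictMono (l : List ℕ) : StrictMono (facesFun l) := by
  induction l with
  | nil => exact strictMono_id
  | cons i l ih =>
    refine fun a b hab => ih ?_
    unfold dFun
    split_ifs <;> omega

lemma facesFun_eq_of_lt (l : List ℕ) (j : ℕ) (h : ∀ i ∈ l, j < i) : facesFun l j = j := by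
  induction l with
  | nil => rfl
  | cons i l ih =>
    simp only [List.mem_cons, forall_eq_or_imp] at h
    rw [facesFun, dFun, if_pos h.1, ih h.2]

/-- The head `i` is smaller than every index in the tail, so the tail's vertex map fixes `i`. Being
injective, it could only hit `i` from `i`, which `dFun i` misses. -/
lemma facesFun_notMem (l : List ℕ) (hl : l.Pairwise (· < ·)) (j : ℕ) : facesFun l j ∉ l := by
  induction l generalizing j with
  | nil => simp
  | cons i l ih =>
    rw [List.pairwise_cons] at hl
    rw [facesFun, List.mem_cons, not_or]
    refine ⟨fun h => ?_, ih hl.2 _⟩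
    have h1 : facesFun l (dFun i j) = facesFun l i := h.trans (facesFun_eq_of_lt l i hl.1).symm
    have h2 := (facesFun_strictMono l).injective h1
    unfold dFun at h2
    split_ifs at h2 <;> omega

/-- A surviving vertex guarantees that the dimension `m - l.length` is not truncated. -/
lemma length_le_of_notMem {m : ℕ} (l : List ℕ) (hl : l.Pairwise (· < ·)) (hm : ∀ i ∈ l, i ≤ m)
    (v : ℕ) (hv : v ≤ m) (hvl : v ∉ l) : l.length ≤ m := by
  have h1 : l.toFinset ⊆ (Finset.range (m + 1)).erase v := by
    intro i hi
    rw [List.mem_toFinset] at hi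
    have := hm i hi
    simp only [Finset.mem_erase, Finset.mem_range]
    exact ⟨fun h => hvl (h ▸ hi), by omega⟩
  have h2 := Finset.card_le_card h1
  rw [List.toFinset_card_of_nodup (hl.imp ne_of_lt), Finset.card_erase_of_mem
    (Finset.mem_range.2 (by omega)), Finset.card_range] at h2
  simpa using h2

/-- A composite of face operators with increasing indices deletes the vertices with these
indices. -/
lemma isFaceOn_faces {X : SSet.{u}} {m : ℕ} (x : Simplex X m) (l : List ℕ)
    (hl : l.Pairwise (· < ·)) (hm : ∀ i ∈ l, i ≤ m) (v : ℕ) (hv : v ≤ m) (hvl : v ∉ l)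
    (V : Set ℕ) (hV : ∀ w ≤ m, w ∈ V ↔ w ∉ l) : IsFaceOn x V (faces X l x) := by
  have hlen := length_le_of_notMem l hl hm v hv hvl
  obtain ⟨θ, h1, h2⟩ := faces_eq_map X x l hlen
  have hθ : StrictMono (θ.toOrderHom : Fin (m - l.length + 1) → Fin (m + 1)) := by
    intro i j hij
    have := facesFun_strictMono l (Fin.lt_def.1 hij)
    rw [← h2, ← h2] at this
    exact Fin.lt_def.2 this
  refine ⟨θ, hθ, fun w => (hV w (by have := w.2; omega)).trans ⟨fun hw => ?_, ?_⟩, h1⟩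
  -- The image of `θ` avoids `l`, and it has as many elements as the complement of `l`; hence it is
  -- all of it.
  · have h3 : (Finset.univ.image fun j : Fin (m - l.length + 1) => (θ.toOrderHom j : ℕ)) =
        Finset.range (m + 1) \ l.toFinset := by
      refine Finset.eq_of_subset_of_card_le ?_ ?_
      · intro i hi
        obtain ⟨j, -, rfl⟩ := Finset.mem_image.1 hi
        rw [Finset.mem_sdiff, Finset.mem_range, List.mem_toFinset]
        refine ⟨(θ.toOrderHom j).2, ?_⟩
        rw [h2]
        exact facesFun_notMem l hl j
      · have hc : (Finset.univ.image fun j : Fin (m - l.length + 1) =>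
            (θ.toOrderHom j : ℕ)).card = m - l.length + 1 := by
          rw [Finset.card_image_of_injective _ fun i j h => hθ.injective (Fin.ext h)]
          simp
        rw [hc, Finset.card_sdiff_of_subset, Finset.card_range,
          List.toFinset_card_of_nodup (hl.imp ne_of_lt)]
        · omega
        · intro i hi
          have := hm i (List.mem_toFinset.1 hi)
          simp; omega
    have h4 : (w : ℕ) ∈ Finset.range (m + 1) \ l.toFinset := by
      rw [Finset.mem_sdiff, Finset.mem_range, List.mem_toFinset]
      exact ⟨w.2, hw⟩
    rw [← h3] at h4
    obtain ⟨j, -, hj⟩ := Finset.mem_image.1 h4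
    exact ⟨j, Fin.ext hj⟩
  · rintro ⟨j, rfl⟩
    have := facesFun_notMem l hl j
    rwa [← h2] at this

/-! ### Peeling off the innermost factor `t SHI` -/

/-- Transport of tensor chains along an equality of degrees. -/
noncomputable def castDeg (R : Type v) [CommRing R] (X Y : SSet.{u}) {k l : ℕ} (h : k = l) :
    TChain R X Y k →ₗ[R] TChain R X Y l := h ▸ LinearMap.id

lemma castDeg_tcls (R : Type v) [CommRing R] {X Y : SSet.{u}} {p q p' q' k k' m m' : ℕ}
    (hk : k = k') (h : p + q = k) (h' : p' + q' = k') {a : Simplex X m} {b : Simplex Y m'}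
    {U V : Set ℕ} {x : Simplex X p} {y : Simplex Y q} {x' : Simplex X p'} {y' : Simplex Y q'}
    (hx : IsFaceOn a U x) (hx' : IsFaceOn a U x') (hy : IsFaceOn b V y) (hy' : IsFaceOn b V y') :
    castDeg R X Y hk (tcls R h x y) = tcls R h' x' y' := by
  obtain ⟨rfl, rfl⟩ := hx.unique hx'
  obtain ⟨rfl, rfl⟩ := hy.unique hy'
  subst hk
  rfl

/-- Transport of normalized chains along an equality of degrees. -/
noncomputable def castChain (R : Type v) [CommRing R] (X : SSet.{u}) {k l : ℕ} (h : k = l) :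
    NChain R X k →ₗ[R] NChain R X l := h ▸ LinearMap.id

lemma swap_SHI_castChain (R : Type v) [CommRing R] (X : SSet.{u}) {k l : ℕ} (h : k = l)
    (h' : k + 1 = l + 1) (z : NChain R (X ⊗ X) k) :
    swap R X (l + 1) (SHI R X X l (castChain R (X ⊗ X) h z)) =
      castChain R (X ⊗ X) h' (swap R X (k + 1) (SHI R X X k z)) := by
  subst h
  rfl

lemma AW_castChain (R : Type v) [CommRing R] (X : SSet.{u}) {k l : ℕ} (h : k = l)
    (z : NChain R (X ⊗ X) k) :
    AW R X X l (castChain R (X ⊗ X) h z) = castDeg R X X h (AW R X X k z) := by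
  subst h
  rfl

/-- `tSHIpow` adds factors on the outside, whereas the induction needs the first one split off. The
degrees `m + (n + 1)` and `m + 1 + n` are only propositionally equal, hence the transport. -/
lemma tSHIpow_succ' (R : Type v) [CommRing R] (X : SSet.{u}) (m n : ℕ)
    (z : NChain R (X ⊗ X) m) :
    tSHIpow R X m (n + 1) z = castChain R (X ⊗ X) (by omega)
      (tSHIpow R X (m + 1) n (swap R X (m + 1) (SHI R X X m z))) := by
  induction n with
  | zero => rfl
  | succ n ih =>
    change swap R X (m + (n + 1) + 1) (SHI R X X (m + (n + 1)) (tSHIpow R X m (n + 1) z)) = _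
    rw [ih, swap_SHI_castChain]
    rfl

lemma hMap_succ' (R : Type v) [CommRing R] (X : SSet.{u}) (n m : ℕ) (z : NChain R (X ⊗ X) m) :
    hMap R X (n + 1) m z = castDeg R X X (by omega)
      (hMap R X n (m + 1) (swap R X (m + 1) (SHI R X X m z))) := by
  change AW R X X (m + (n + 1)) (tSHIpow R X m (n + 1) z) = _
  rw [tSHIpow_succ', AW_castChain]
  rfl

/-! ### Vertex sets of the terms of the explicit formula -/

/-- The vertices that remain in the two arguments of `h_n` in the term with indices
`e 0, …, e n` are those in the two components of `vertexSets e (n + 1)`. -/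
def vertexSets (e : ℕ → ℕ) : ℕ → Set ℕ × Set ℕ
  | 0 => (∅, Set.univ)
  | k + 1 => ((vertexSets e k).2 ∩ Set.Iic (e k), (vertexSets e k).1 ∪ Set.Ici (e k))

lemma vertexSets_congr {e e' : ℕ → ℕ} (k : ℕ) (h : ∀ j < k, e j = e' j) :
    vertexSets e k = vertexSets e' k := by
  induction k with
  | zero => rfl
  | succ k ih => rw [vertexSets, vertexSets, ih fun j hj => h j (by omega), h k (by omega)]

lemma mem_vertexSets_fst {e : ℕ → ℕ} {k v : ℕ} :
    v ∈ (vertexSets e (k + 1)).1 ↔ v ∈ (vertexSets e k).2 ∧ v ≤ e k := Iff.rfl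

lemma mem_vertexSets_snd {e : ℕ → ℕ} {k v : ℕ} :
    v ∈ (vertexSets e (k + 1)).2 ↔ v ∈ (vertexSets e k).1 ∨ e k ≤ v := Iff.rfl

lemma le_of_forall_lt_succ {e : ℕ → ℕ} {n : ℕ} (he : ∀ j < n, e j < e (j + 1)) {j k : ℕ}
    (hjk : j ≤ k) (hk : k ≤ n) : e j ≤ e k := by
  induction k, hjk using Nat.le_induction with
  | base => exact le_rfl
  | succ k hjk ih => exact (ih (by omega)).trans (he k (by omega)).le

lemma exists_lt_succ_block {e : ℕ → ℕ} {P : ℕ → Prop} {n v : ℕ} :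
    (∃ j < n + 1, P j ∧ e j < v ∧ v < e (j + 1)) ↔
      (∃ j < n, P j ∧ e j < v ∧ v < e (j + 1)) ∨ P n ∧ e n < v ∧ v < e (n + 1) := by
  constructor
  · rintro ⟨j, hj, h⟩
    rcases Nat.lt_succ_iff_lt_or_eq.1 hj with hj | rfl
    · exact Or.inl ⟨j, hj, h⟩
    · exact Or.inr h
  · rintro (⟨j, hj, h⟩ | h)
    · exact ⟨j, by omega, h⟩
    · exact ⟨n, by omega, h⟩

/-- Each step of the recursion exchanges the components, so parity tells which one belongs to the
left factor. The last deleted block is open-ended at stage `n`; adjoining `Set.Ici (e (n + 1))`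
closes it, while cutting the other set down to `Set.Iic (e (n + 1))` opens the next one. -/
lemma mem_vertexSets_iff {e : ℕ → ℕ} (n : ℕ) (he : ∀ j < n, e j < e (j + 1)) (v : ℕ) :
    (v ∈ (if Even n then (vertexSets e (n + 1)).1 else (vertexSets e (n + 1)).2) ↔
      ¬ ((∃ j < n, Even j ∧ e j < v ∧ v < e (j + 1)) ∨ Even n ∧ e n < v)) ∧
    (v ∈ (if Even n then (vertexSets e (n + 1)).2 else (vertexSets e (n + 1)).1) ↔
      ¬ (v < e 0 ∨ (∃ j < n, ¬ Even j ∧ e j < v ∧ v < e (j + 1)) ∨ ¬ Even n ∧ e n < v)) := by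
  induction n with
  | zero => simp [vertexSets]
  | succ n ih =>
    obtain ⟨ih1, ih2⟩ := ih fun j hj => he j (by omega)
    have h0 : e (n + 1) ≤ v → ¬ v < e 0 := fun h h' => by
      have := le_of_forall_lt_succ he (Nat.zero_le (n + 1)) le_rfl
      omega
    -- A vertex `v ≥ e (n + 1)` lies beyond all completed blocks. Together with `h0` this makes the
    -- remaining claims propositional.
    have hP : ∀ P : ℕ → Prop, e (n + 1) ≤ v → ¬ ∃ j < n, P j ∧ e j < v ∧ v < e (j + 1) := by
      rintro P h ⟨j, hj, -, -, h'⟩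
      have := le_of_forall_lt_succ he (show j + 1 ≤ n + 1 by omega) le_rfl
      omega
    have h1 := hP Even
    have h2 := hP fun j => ¬ Even j
    have h3 := he n (by omega)
    simp only [exists_lt_succ_block (P := Even), exists_lt_succ_block (P := fun j => ¬ Even j)]
    by_cases hn : Even n
    · have hn' : ¬ Even (n + 1) := by simp [Nat.even_add_one, hn]
      simp only [hn, hn', if_true, if_false, not_true_eq_false, true_and, false_and, or_false,
        not_false_eq_true] at ih1 ih2 ⊢
      rw [mem_vertexSets_snd (k := n + 1), mem_vertexSets_fst (k := n + 1), ih1, ih2]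
      generalize (∃ j < n, Even j ∧ e j < v ∧ v < e (j + 1)) = P at *
      generalize (∃ j < n, ¬ Even j ∧ e j < v ∧ v < e (j + 1)) = Q at *
      constructor <;> grind
    · have hn' : Even (n + 1) := by simp [Nat.even_add_one, hn]
      simp only [hn, hn', if_true, if_false, not_true_eq_false, true_and, false_and, or_false,
        not_false_eq_true] at ih1 ih2 ⊢
      rw [mem_vertexSets_snd (k := n + 1), mem_vertexSets_fst (k := n + 1), ih1, ih2]
      generalize (∃ j < n, Even j ∧ e j < v ∧ v < e (j + 1)) = P at *
      generalize (∃ j < n, ¬ Even j ∧ e j < v ∧ v < e (j + 1)) = Q at *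
      constructor <;> grind

/-! ### Index tuples and the lists of faces -/

lemma extIdx_succ_n {n : ℕ} (m : ℕ) (i : Fin (n + 1) → ℕ) : extIdx m i (n + 1) = m + 1 := by
  simp [extIdx]

/-- The convention `i_{n+1} = m + 1` absorbs the upper bound `m`, and the lower bounds `k ≤ i_k`
hold for any strictly increasing sequence of natural numbers. -/
lemma mem_indices {n m : ℕ} {i : Fin (n + 1) → ℕ} :
    i ∈ indices n m ↔ ∀ k < n + 1, extIdx m i k < extIdx m i (k + 1) := by
  constructor
  · intro hi k hk
    simp only [indices, Finset.mem_filter, Fintype.mem_piFinset, Finset.mem_Icc] at hi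
    by_cases hk' : k < n
    · have := hi.2 ⟨k, hk'⟩
      simpa [extIdx, hk, hk'] using this
    · obtain rfl : k = n := by omega
      have := (hi.1 ⟨k, hk⟩).2
      simp [extIdx]
      omega
  · intro h
    have h1 : ∀ k ≤ n, k ≤ extIdx m i k := by
      intro k
      induction k with
      | zero => omega
      | succ k ih =>
        intro hk
        have := ih (by omega)
        have := h k (by omega)
        omega
    simp only [indices, Finset.mem_filter, Fintype.mem_piFinset, Finset.mem_Icc]
    have h4 : ∀ k : Fin (n + 1), extIdx m i k = i k := fun k => dif_pos k.2
    refine ⟨fun k => ⟨?_, ?_⟩, fun k => ?_⟩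
    · have := h1 k (by omega)
      rwa [h4] at this
    · have h2 := le_of_forall_lt_succ h (show (k : ℕ) ≤ n by omega) (by omega)
      have h3 := h n (by omega)
      rw [extIdx_succ_n] at h3
      rw [h4] at h2
      omega
    · have := h k (by omega)
      have hk := k.2
      simp only [extIdx, show (k : ℕ) < n + 1 by omega, show (k : ℕ) + 1 < n + 1 by omega,
        dif_pos] at this
      exact this

lemma mem_block {n m : ℕ} {i : Fin (n + 1) → ℕ} {k v : ℕ} :
    v ∈ block m i k ↔ extIdx m i k < v ∧ v < extIdx m i (k + 1) := by
  simp only [block, consec, List.mem_range'_1]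
  omega

lemma mem_leftFaces {n m : ℕ} {i : Fin (n + 1) → ℕ} {v : ℕ} :
    v ∈ leftFaces m i ↔ ∃ k < n + 1, Even k ∧ extIdx m i k < v ∧ v < extIdx m i (k + 1) := by
  simp [leftFaces, mem_block, and_assoc]

lemma mem_rightFaces {n m : ℕ} {i : Fin (n + 1) → ℕ} {v : ℕ} :
    v ∈ rightFaces m i ↔ v < extIdx m i 0 ∨
      ∃ k < n + 1, ¬ Even k ∧ extIdx m i k < v ∧ v < extIdx m i (k + 1) := by
  simp [rightFaces, mem_block, and_assoc, consec]

lemma pairwise_flatMap_block {n m : ℕ} {i : Fin (n + 1) → ℕ} (hi : i ∈ indices n m)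
    (p : ℕ → Bool) : (((List.range (n + 1)).filter p).flatMap (block m i)).Pairwise (· < ·) := by
  rw [List.pairwise_flatMap]
  refine ⟨fun k _ => List.pairwise_lt_range', ?_⟩
  have h : (List.range (n + 1)).Pairwise fun j k =>
      ∀ x ∈ block m i j, ∀ y ∈ block m i k, x < y := by
    refine List.Pairwise.imp_of_mem ?_ List.pairwise_lt_range
    intro j k _ hk hjk x hx y hy
    rw [mem_block] at hx hy
    rw [List.mem_range] at hk
    have := le_of_forall_lt_succ (mem_indices.1 hi) (show j + 1 ≤ k by omega) (by omega)
    omega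
  exact h.filter p

lemma pairwise_leftFaces {n m : ℕ} {i : Fin (n + 1) → ℕ} (hi : i ∈ indices n m) :
    (leftFaces m i).Pairwise (· < ·) := pairwise_flatMap_block hi _

lemma pairwise_rightFaces {n m : ℕ} {i : Fin (n + 1) → ℕ} (hi : i ∈ indices n m) :
    (rightFaces m i).Pairwise (· < ·) := by
  rw [rightFaces, List.pairwise_append]
  refine ⟨List.pairwise_lt_range', pairwise_flatMap_block hi _, ?_⟩
  intro x hx y hy
  simp only [List.mem_flatMap, List.mem_filter, List.mem_range, mem_block] at hy
  obtain ⟨k, ⟨hk, -⟩, hy, -⟩ := hy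
  have := le_of_forall_lt_succ (mem_indices.1 hi) (Nat.zero_le k) (by omega)
  simp only [consec, List.mem_range'_1] at hx
  omega

section

variable {n m : ℕ} {i : Fin (n + 1) → ℕ}

lemma extIdx_le (hi : i ∈ indices n m) {k : ℕ} (hk : k ≤ n) : extIdx m i k ≤ m := by
  have h1 := le_of_forall_lt_succ (mem_indices.1 hi) hk (by omega)
  have h2 := mem_indices.1 hi n (by omega)
  rw [extIdx_succ_n] at h2
  omega

lemma isFaceOn_leftFaces (hi : i ∈ indices n m) {X : SSet.{u}} (x : Simplex X m) :
    IsFaceOn x (if Even n then (vertexSets (extIdx m i) (n + 1)).1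
      else (vertexSets (extIdx m i) (n + 1)).2) (faces X (leftFaces m i) x) := by
  have he := mem_indices.1 hi
  have hle := fun k hk => le_of_forall_lt_succ he (Nat.zero_le k) hk
  -- The vertex `i_0` is retained in both tensor factors, so it serves as the surviving vertex here
  -- and for `rightFaces`.
  refine isFaceOn_faces x _ (pairwise_leftFaces hi) ?_ (extIdx m i 0)
    (extIdx_le hi (by omega)) ?_ _ fun w hw => ?_
  · intro v hv
    obtain ⟨k, hk, -, -, h⟩ := mem_leftFaces.1 hv
    have := le_of_forall_lt_succ he (show k + 1 ≤ n + 1 by omega) le_rfl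
    rw [extIdx_succ_n] at this
    omega
  · rw [mem_leftFaces]
    rintro ⟨k, hk, -, h, -⟩
    have := hle k (by omega)
    omega
  · rw [(mem_vertexSets_iff n (fun j hj => he j (by omega)) w).1, mem_leftFaces,
      exists_lt_succ_block (P := Even), extIdx_succ_n]
    simp only [show w < m + 1 by omega, and_true]

lemma isFaceOn_rightFaces (hi : i ∈ indices n m) {X : SSet.{u}} (x : Simplex X m) :
    IsFaceOn x (if Even n then (vertexSets (extIdx m i) (n + 1)).2
      else (vertexSets (extIdx m i) (n + 1)).1) (faces X (rightFaces m i) x) := by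
  have he := mem_indices.1 hi
  have hle := fun k hk => le_of_forall_lt_succ he (Nat.zero_le k) hk
  refine isFaceOn_faces x _ (pairwise_rightFaces hi) ?_ (extIdx m i 0)
    (extIdx_le hi (by omega)) ?_ _ fun w hw => ?_
  · intro v hv
    rcases mem_rightFaces.1 hv with h | ⟨k, hk, -, -, h⟩
    · have := extIdx_le hi (Nat.zero_le n)
      omega
    · have := le_of_forall_lt_succ he (show k + 1 ≤ n + 1 by omega) le_rfl
      rw [extIdx_succ_n] at this
      omega
  · rw [mem_rightFaces]
    rintro (h | ⟨k, hk, -, h, -⟩)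
    · omega
    · have := hle k (by omega)
      omega
  · rw [(mem_vertexSets_iff n (fun j hj => he j (by omega)) w).2, mem_rightFaces,
      exists_lt_succ_block (P := fun j => ¬ Even j), extIdx_succ_n]
    simp only [show w < m + 1 by omega, and_true]

end

/-! ### Unsigned terms applied to pulled-back simplices -/

/-- The summand of the explicit formula for `h_n (x × y)` with indices `i`, without its sign. -/
noncomputable def hTerm (R : Type v) [CommRing R] {X : SSet.{u}} {n m : ℕ} (i : indices n m)
    (x y : Simplex X m) : TChain R X X (m + n) :=
  if Even n then tcls R (degree_eq i) (faces X (leftFaces m i.1) x) (faces X (rightFaces m i.1) y)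
  else tcls R (degree_eq i) (faces X (leftFaces m i.1) y) (faces X (rightFaces m i.1) x)

/-- The first argument is always restricted to the first vertex set; only the tensor factor it
occupies depends on the parity of `n`. A collapse of two retained vertices makes that factor
degenerate. -/
lemma hTerm_map_eq_zero_fst (R : Type v) [CommRing R] {X : SSet.{u}} {n m k : ℕ}
    (i : indices n m) (G : ⦋m⦌ ⟶ ⦋k⦌) (x : Simplex X k) (y : Simplex X m) (v w : Fin (m + 1))
    (hv : (v : ℕ) ∈ (vertexSets (extIdx m i.1) (n + 1)).1)
    (hw : (w : ℕ) ∈ (vertexSets (extIdx m i.1) (n + 1)).1) (hvw : v < w)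
    (hG : G.toOrderHom v = G.toOrderHom w) : hTerm R i (X.map G.op x) y = 0 := by
  rw [hTerm]
  have h1 := isFaceOn_leftFaces i.2 (X.map G.op x)
  have h2 := isFaceOn_rightFaces i.2 (X.map G.op x)
  by_cases hn : Even n
  · rw [if_pos hn] at h1 ⊢
    exact tcls_eq_zero_left R _ _ (h1.mem_degenerate G v w hv hw hvw hG)
  · rw [if_neg hn] at h2 ⊢
    exact tcls_eq_zero_right R _ _ (h2.mem_degenerate G v w hv hw hvw hG)

lemma hTerm_map_eq_zero_snd (R : Type v) [CommRing R] {X : SSet.{u}} {n m k : ℕ}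
    (i : indices n m) (F : ⦋m⦌ ⟶ ⦋k⦌) (x : Simplex X m) (y : Simplex X k) (v w : Fin (m + 1))
    (hv : (v : ℕ) ∈ (vertexSets (extIdx m i.1) (n + 1)).2)
    (hw : (w : ℕ) ∈ (vertexSets (extIdx m i.1) (n + 1)).2) (hvw : v < w)
    (hF : F.toOrderHom v = F.toOrderHom w) : hTerm R i x (X.map F.op y) = 0 := by
  rw [hTerm]
  have h1 := isFaceOn_leftFaces i.2 (X.map F.op y)
  have h2 := isFaceOn_rightFaces i.2 (X.map F.op y)
  by_cases hn : Even n
  · rw [if_pos hn] at h2 ⊢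
    exact tcls_eq_zero_right R _ _ (h2.mem_degenerate F v w hv hw hvw hF)
  · rw [if_neg hn] at h1 ⊢
    exact tcls_eq_zero_left R _ _ (h1.mem_degenerate F v w hv hw hvw hF)

/-- The components are crossed because of `t`: `b` is the first argument for `h_n` and the second
for `h_{n+1}`. Equality of the terms is then a comparison of vertex sets. -/
lemma castDeg_hTerm_map (R : Type v) [CommRing R] {X : SSet.{u}} {n m k : ℕ}
    (i : indices n m) (i' : indices (n + 1) k) (F G : ⦋m⦌ ⟶ ⦋k⦌) (a b : Simplex X k)
    (h : m + n = k + (n + 1))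
    (hG : ∀ u v : Fin (m + 1), (u : ℕ) ∈ (vertexSets (extIdx m i.1) (n + 1)).1 →
      (v : ℕ) ∈ (vertexSets (extIdx m i.1) (n + 1)).1 → u < v → G.toOrderHom u < G.toOrderHom v)
    (hF : ∀ u v : Fin (m + 1), (u : ℕ) ∈ (vertexSets (extIdx m i.1) (n + 1)).2 →
      (v : ℕ) ∈ (vertexSets (extIdx m i.1) (n + 1)).2 → u < v → F.toOrderHom u < F.toOrderHom v)
    (hG' : ∀ w : Fin (k + 1), (w : ℕ) ∈ (vertexSets (extIdx k i'.1) (n + 1 + 1)).2 ↔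
      ∃ v : Fin (m + 1), (v : ℕ) ∈ (vertexSets (extIdx m i.1) (n + 1)).1 ∧ G.toOrderHom v = w)
    (hF' : ∀ w : Fin (k + 1), (w : ℕ) ∈ (vertexSets (extIdx k i'.1) (n + 1 + 1)).1 ↔
      ∃ v : Fin (m + 1), (v : ℕ) ∈ (vertexSets (extIdx m i.1) (n + 1)).2 ∧ F.toOrderHom v = w) :
    castDeg R X X h (hTerm R i (X.map G.op b) (X.map F.op a)) = hTerm R i' a b := by
  have g1 := isFaceOn_leftFaces i.2 (X.map G.op b)
  have g2 := isFaceOn_rightFaces i.2 (X.map G.op b)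
  have f1 := isFaceOn_leftFaces i.2 (X.map F.op a)
  have f2 := isFaceOn_rightFaces i.2 (X.map F.op a)
  have a1 := isFaceOn_leftFaces i'.2 a
  have a2 := isFaceOn_rightFaces i'.2 a
  have b1 := isFaceOn_leftFaces i'.2 b
  have b2 := isFaceOn_rightFaces i'.2 b
  rw [hTerm, hTerm]
  by_cases hn : Even n
  · have hn' : ¬ Even (n + 1) := by simp [Nat.even_add_one, hn]
    simp only [hn, hn', if_true, if_false] at *
    exact castDeg_tcls R h _ _ (g1.of_map G hG hG') b1 (f2.of_map F hF hF') a2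
  · have hn' : Even (n + 1) := by simp [Nat.even_add_one, hn]
    simp only [hn, hn', if_true, if_false] at *
    exact castDeg_tcls R h _ _ (f1.of_map F hF hF') a1 (g2.of_map G hG hG') b2

/-! ### The surviving shuffle -/

/-- Treats `k = 0`, where the set is everything and the hypothesis is vacuous, together with `k >
0`. -/
lemma mem_vertexSets_snd_of_forall {e : ℕ → ℕ} {k v : ℕ} (h : ∀ j, j + 1 = k → e j ≤ v) :
    v ∈ (vertexSets e k).2 := by
  obtain _ | k := k
  · exact Set.mem_univ _
  · exact mem_vertexSets_snd.2 (Or.inr (h k rfl))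

lemma exists_le_of_mem_vertexSets_fst {e : ℕ → ℕ} {k v : ℕ} (h : v ∈ (vertexSets e k).1) :
    ∃ j < k, v ≤ e j := by
  obtain _ | k := k
  · exact h.elim
  · exact ⟨k, by omega, h.2⟩

lemma below_eq_of_forall_notMem (A : Finset ℕ) {s t : ℕ} (hst : s ≤ t)
    (h : ∀ x, s ≤ x → x < t → x ∉ A) : below A s = below A t := by
  unfold below
  congr 1
  ext x
  simp only [Finset.mem_filter, and_congr_right_iff]
  intro hx
  constructor
  · omega
  · intro hxt
    by_contra hxs
    exact h x (by omega) hxt hx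

lemma below_Ico (s t r : ℕ) : below (Finset.Ico s t) r = min r t - s := by
  have : (Finset.Ico s t).filter (· < r) = Finset.Ico s (min r t) := by
    ext x; simp; omega
  rw [below, this, Nat.card_Ico]

/-- The shuffle with `α = {q, …, q + p - 1}`. -/
def Shuffle.last (p q : ℕ) : Shuffle p q :=
  ⟨Finset.Ico q (p + q), Finset.mem_powersetCard.2
    ⟨fun x hx => by simp at hx ⊢; omega, by simp⟩⟩

/-- Each of the `p` elements of `α` is shifted by `q` from its position. -/
lemma Shuffle.sig_last (p q : ℕ) : (Shuffle.last p q).sig = q * p := by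
  have h : ∑ x ∈ Finset.Ico q (p + q), x = q * p + ∑ i ∈ Finset.range p, i := by
    rw [Finset.sum_Ico_eq_sum_range, Finset.sum_add_distrib]
    simp [mul_comm]
  simp [Shuffle.sig, Shuffle.last, h]

lemma Shuffle.below_last (p q r : ℕ) (hr : r ≤ p + q) :
    below (Shuffle.last p q).1 r = r - q := by
  rw [Shuffle.last, below_Ico]; omega

lemma Shuffle.below_compl_last (p q r : ℕ) (hr : r ≤ p + q) :
    below (Shuffle.last p q).compl r = min r q := by
  have h1 := below_add_compl (Shuffle.last p q) r hr
  rw [Shuffle.below_last p q r hr] at h1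
  omega

/-- The only shuffle for which neither component of the Shih operator degenerates. -/
lemma shuffle_eq_last {m n p q : ℕ} (h : p + q < m) (S : Shuffle (p + 1) q) (e F G : ℕ → ℕ)
    (he : ∀ k < n, e k < e (k + 1)) (hen : e n ≤ m + 1)
    (hF : ∀ v ≤ m + 1, F v = if v < m - p - q then v
      else m - p - q - 1 + below S.1 (v - (m - p - q)))
    (hG : ∀ v ≤ m + 1, G v = if v < m - p - q then v
      else m - q + below S.compl (v - (m - p - q)))
    (hFinj : ∀ v w, v < w → w ≤ m + 1 → v ∈ (vertexSets e (n + 1)).2 →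
      w ∈ (vertexSets e (n + 1)).2 → F v ≠ F w)
    (hGinj : ∀ v w, v < w → w ≤ m + 1 → v ∈ (vertexSets e (n + 1)).1 →
      w ∈ (vertexSets e (n + 1)).1 → G v ≠ G w) :
    e n = m - p - q + q ∧ (∀ k < n, e k + 1 < m - p - q) ∧ S = Shuffle.last (p + 1) q := by
  have hY : ∀ v, e n ≤ v → v ∈ (vertexSets e (n + 1)).2 := fun v hv => Or.inr hv
  have hX : ∀ v ≤ e n, (∀ k, k + 1 = n → e k ≤ v) → v ∈ (vertexSets e (n + 1)).1 :=
    fun v hv hk => ⟨mem_vertexSets_snd_of_forall hk, hv⟩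
  have hpq : m - p - q + p + q = m := by omega
  generalize m - p - q = r at *
  have hFr : F r = r - 1 := by
    rw [hF r (by omega)]; simp [below]
  have hFr' : F (r - 1) = r - 1 := by
    rw [hF _ (by omega), if_pos (by omega)]
  -- `F` identifies `r - 1` and `r` because of the degeneracy `s_{m̄-1}`, and the second set
  -- contains every vertex from `e n` on.
  have h1 : r ≤ e n := by
    by_contra h1
    exact hFinj (r - 1) r (by omega) (by omega) (hY _ (by omega)) (hY _ (by omega))
      (hFr'.trans hFr.symm)
  have hS : ∀ t, t < p + 1 + q → (t ∈ S.compl ↔ t ∉ S.1) := by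
    intro t ht; simp [Shuffle.compl, ht]
  have hFt : ∀ t, r + t ≤ m + 1 → F (r + t) = r - 1 + below S.1 t := by
    intro t ht
    rw [hF _ ht, if_neg (by omega), Nat.add_sub_cancel_left]
  have hGt : ∀ t, r + t ≤ m + 1 → G (r + t) = m - q + below S.compl t := by
    intro t ht
    rw [hG _ ht, if_neg (by omega), Nat.add_sub_cancel_left]
  -- The vertices from `e (n - 1)` to `e n` lie in the first set, and `G` does not move from `r + t`
  -- to `r + t + 1` when `t` is in `α`.
  have h2 : ∀ t, r + t < e n → (∀ k, k + 1 = n → e k ≤ r + t) → t ∉ S.1 := by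
    intro t ht hk htS
    refine hGinj (r + t) (r + t + 1) (by omega) (by omega) (hX _ (by omega) hk)
      (hX _ (by omega) fun k hk' => (hk k hk').trans (by omega)) ?_
    rw [add_assoc, hGt _ (by omega), hGt _ (by omega), below_succ,
      if_neg fun hc => (hS t (by omega)).1 hc htS, add_zero]
  -- Symmetrically, `F` does not move from `r + t` to `r + t + 1` when `t` is in `β`, and these
  -- vertices lie in the second set.
  have h3 : ∀ t, e n ≤ r + t → r + t ≤ m → t ∈ S.1 := by
    intro t ht htm
    by_contra htS
    refine hFinj (r + t) (r + t + 1) (by omega) (by omega) (hY _ (by omega))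
      (hY _ (by omega)) ?_
    rw [add_assoc, hFt _ (by omega), hFt _ (by omega), below_succ]
    simp [htS]
  -- Both `e (n - 1)` and `e n` lie in the second set. If `e (n - 1) ≥ r - 1`, then by `h2` no
  -- element of `α` falls between them, so `F` takes the same value at both.
  have h4 : ∀ k, k + 1 = n → e k + 1 < r := by
    rintro k rfl
    by_contra hk
    have hkn := he k (by omega)
    have hmem : e k ∈ (vertexSets e (k + 1 + 1)).2 :=
      Or.inl ⟨mem_vertexSets_snd_of_forall fun j hj => hj ▸ (he j (by omega)).le, le_refl (e k)⟩
    refine hFinj (e k) (e (k + 1)) hkn hen hmem (hY _ le_rfl) ?_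
    -- With truncated subtraction `r + (e k - r)` is `max r (e k)`. In the boundary case `e k = r -
    -- 1` this is `r`, where `F` has the same value as at `r - 1`.
    have e1 : F (r + (e k - r)) = F (r + (e (k + 1) - r)) := by
      rw [hFt _ (by omega), hFt _ (by omega)]
      congr 1
      refine below_eq_of_forall_notMem _ (by omega) fun x hx hx' => h2 x (by omega) ?_
      intro j hj
      obtain rfl : j = k := by omega
      omega
    have e2 : r + (e (k + 1) - r) = e (k + 1) := by omega
    rw [e2] at e1
    rw [← e1]
    by_cases hkr : r ≤ e k
    · congr 1; omega
    · have e3 : e k = r - 1 := by omega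
      rw [e3, hFr', ← hFr]
      congr 1; omega
  have h5 : S.1 = Finset.Ico (e n - r) (p + 1 + q) := by
    ext t
    rw [Finset.mem_Ico]
    constructor
    · intro ht
      have ht' := Finset.mem_range.1 ((Finset.mem_powersetCard.1 S.2).1 ht)
      refine ⟨?_, ht'⟩
      by_contra hlt
      exact h2 t (by omega) (fun k hk => by have := h4 k hk; omega) ht
    · intro ht
      exact h3 t (by omega) (by omega)
  -- So `α` is a final segment, and its cardinality `p + 1` fixes where it begins.
  have h6 := S.card_alpha
  rw [h5, Nat.card_Ico] at h6
  have h7 : e n - r = q := by omega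
  refine ⟨by omega, fun k hk => ?_, Subtype.ext ?_⟩
  · obtain _ | n := n
    · omega
    · have := h4 n rfl
      have := le_of_forall_lt_succ he (show k ≤ n by omega) (by omega)
      omega
  · rw [h5, h7]; rfl

lemma shi_hTerm_ne_zero (R : Type v) [CommRing R] {X : SSet.{u}} {n m p q : ℕ} (h : p + q < m)
    (S : Shuffle (p + 1) q) (i : indices n (m + 1)) (a b : Simplex X m)
    (hne : hTerm R i (shiSnd X p q h S b) (shiFst X p q h S a) ≠ 0) :
    extIdx (m + 1) i.1 n = m - p - q + q ∧ (∀ k < n, extIdx (m + 1) i.1 k + 1 < m - p - q) ∧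
      S = Shuffle.last (p + 1) q := by
  obtain ⟨θ, h1, h2⟩ := shiFst_eq_map X p q h S a
  obtain ⟨η, h3, h4⟩ := shiSnd_eq_map X p q h S b
  rw [h1, h3] at hne
  refine shuffle_eq_last h S (extIdx (m + 1) i.1) _ _
    (fun k hk => mem_indices.1 i.2 k (by omega)) (extIdx_le i.2 le_rfl)
    (fun _ _ => rfl) (fun _ _ => rfl) (fun v w hvw hw hv' hw' e => hne ?_)
    (fun v w hvw hw hv' hw' e => hne ?_)
  · exact hTerm_map_eq_zero_snd R i θ _ a ⟨v, by omega⟩ ⟨w, by omega⟩ hv' hw'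
      (Fin.mk_lt_mk.2 hvw) (Fin.ext ((h2 _).trans (e.trans (h2 ⟨w, by omega⟩).symm)))
  · exact hTerm_map_eq_zero_fst R i η b _ ⟨v, by omega⟩ ⟨w, by omega⟩ hv' hw'
      (Fin.mk_lt_mk.2 hvw) (Fin.ext ((h4 _).trans (e.trans (h4 ⟨w, by omega⟩).symm)))

/-! ### Passage from a term of `h_n` to a term of `h_{n+1}` -/

/-- The relation between the indices of a nonzero term of `h_n` and the indices of the resulting
term of `h_{n+1}`, for a summand of the Shih operator with parameters `p` and `q`. -/
structure IndexRel {n m : ℕ} (p q : ℕ) (i : Fin (n + 1) → ℕ) (i' : Fin (n + 1 + 1) → ℕ) : Prop where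
  eq_of_lt : ∀ k < n, extIdx (m + 1) i k = extIdx m i' k
  last : extIdx (m + 1) i n = m - p - q + q
  last' : extIdx m i' n + 1 = m - p - q
  top' : extIdx m i' (n + 1) + q = m

/-- With `r = m - p - q`, both vertex maps are the identity below `r`. For the last shuffle `θ` is
constant `r - 1` on `[r, r + q]` and then climbs to `m - q`, while `η` maps `[r, r + q]` onto `[m -
q, m]` and then stays at `m`. As `e_n = r + q`, the first set cuts off exactly where `η` stops, and
the upper part of the second set starts where `θ` begins to climb. -/
lemma castDeg_shi_hTerm (R : Type v) [CommRing R] {X : SSet.{u}} {n m p q : ℕ} (h : p + q < m)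
    (i : indices n (m + 1)) (i' : indices (n + 1) m) (hr : IndexRel (m := m) p q i.1 i'.1)
    (a b : Simplex X m) (hd : m + 1 + n = m + (n + 1)) :
    castDeg R X X hd (hTerm R i (shiSnd X p q h (Shuffle.last (p + 1) q) b)
      (shiFst X p q h (Shuffle.last (p + 1) q) a)) = hTerm R i' a b := by
  obtain ⟨θ, h1, h2⟩ := shiFst_eq_map X p q h (Shuffle.last (p + 1) q) a
  obtain ⟨η, h3, h4⟩ := shiSnd_eq_map X p q h (Shuffle.last (p + 1) q) b
  rw [h1, h3]
  have hr' : m - p - q + p + q = m := by omega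
  have e1 := hr.last
  have e2 := hr.last'
  have e3 := hr.top'
  have hc := vertexSets_congr n hr.eq_of_lt
  have hi' : ∀ k < n, extIdx (m + 1) i.1 k + 1 < m - p - q := by
    intro k hk
    rw [hr.eq_of_lt k hk]
    have := le_of_forall_lt_succ (mem_indices.1 i'.2) (show k + 1 ≤ n by omega) (by omega)
    have := mem_indices.1 i'.2 k (by omega)
    omega
  -- Before the index `e_n` enters, the first set lies strictly below `r - 1` and the second set
  -- contains everything from `r - 1` on.
  have hA : ∀ v, v ∈ (vertexSets (extIdx (m + 1) i.1) n).1 → v + 1 < m - p - q := by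
    intro v hv
    obtain ⟨j, hj, hvj⟩ := exists_le_of_mem_vertexSets_fst hv
    have := hi' j hj
    omega
  have hB : ∀ v, m - p - q ≤ v + 1 → v ∈ (vertexSets (extIdx (m + 1) i.1) n).2 := by
    intro v hv
    refine mem_vertexSets_snd_of_forall fun j hj => ?_
    have := hi' j (by omega)
    omega
  have g2 : ∀ j : Fin (m + 2), (θ.toOrderHom j : ℕ) =
      if (j : ℕ) < m - p - q then (j : ℕ) else m - p - q - 1 + (j - (m - p - q) - q) := by
    intro j
    have := j.2
    rw [h2, Shuffle.below_last _ _ _ (by omega)]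
  have g4 : ∀ j : Fin (m + 2), (η.toOrderHom j : ℕ) =
      if (j : ℕ) < m - p - q then (j : ℕ) else m - q + min (j - (m - p - q)) q := by
    intro j
    have := j.2
    rw [h4, Shuffle.below_compl_last _ _ _ (by omega)]
  have e2' : extIdx m i'.1 n = m - p - q - 1 := by omega
  have e3' : extIdx m i'.1 (n + 1) = m - q := by omega
  refine castDeg_hTerm_map R i i' θ η a b hd ?_ ?_ ?_ ?_ <;>
    simp only [mem_vertexSets_fst, mem_vertexSets_snd, ← hc, e1, e2', e3']
  · rintro u v ⟨-, hu⟩ ⟨-, hv⟩ huv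
    refine Fin.lt_def.2 ?_
    have := Fin.lt_def.1 huv
    rw [g4, g4]
    split_ifs <;> omega
  · rintro u v hu hv huv
    refine Fin.lt_def.2 ?_
    have := Fin.lt_def.1 huv
    have hu' := hu.imp_left (hA u)
    have hv' := hv.imp_left (hA v)
    rw [g2, g2]
    split_ifs <;> omega
  · intro w
    have hw := w.2
    constructor
    · rintro (⟨h5, h6⟩ | h5)
      · refine ⟨⟨w, by omega⟩, ⟨h5, by simp; omega⟩, Fin.ext ?_⟩
        rw [g4, if_pos (by simp; omega)]
      -- The preimage of `w` under `η` in `[r, r + q]`.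
      · refine ⟨⟨w - (m - q) + (m - p - q), by omega⟩, ⟨hB _ (by dsimp only; omega),
          by dsimp only; omega⟩, Fin.ext ?_⟩
        rw [g4, if_neg (by simp)]
        simp; omega
    · rintro ⟨v, ⟨h5, h6⟩, rfl⟩
      rw [g4]
      split_ifs with h7
      · exact Or.inl ⟨h5, by omega⟩
      · right; omega
  · intro w
    have hw := w.2
    constructor
    · rintro ⟨h5 | h5, h6⟩
      · have := hA _ h5
        refine ⟨⟨w, by omega⟩, Or.inl h5, Fin.ext ?_⟩
        rw [g2, if_pos (by simp; omega)]
      -- The preimage of `w` under `θ` in `[r + q, m + 1]`.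
      · refine ⟨⟨w - (m - p - q - 1) + (m - p - q) + q, by omega⟩, Or.inr (by simp),
          Fin.ext ?_⟩
        rw [g2, if_neg (by simp; omega)]
        simp; omega
    · rintro ⟨v, h5 | h5, rfl⟩
      · have := hA _ h5
        rw [g2, if_pos (by omega)]
        exact ⟨Or.inl h5, by omega⟩
      · have := v.2
        rw [g2, if_neg (by omega)]
        exact ⟨Or.inr (by omega), by omega⟩

/-! ### The recursion for the signs -/

lemma sum_range_two_mul (e : ℕ → ℕ) (s : ℕ) :
    ∑ l ∈ Finset.range (2 * s), e l =
      ∑ j ∈ Finset.range s, e (2 * j) + ∑ j ∈ Finset.range s, e (2 * j + 1) := by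
  induction s with
  | zero => simp
  | succ s ih =>
    rw [mul_add, mul_one, Finset.sum_range_succ, Finset.sum_range_succ, ih,
      Finset.sum_range_succ _ s, Finset.sum_range_succ _ s]
    omega

lemma signC_congr {e e' : ℕ → ℕ} {n : ℕ} (h : ∀ k ≤ 2 * (n / 2), e k = e' k) :
    signC n e = signC n e' := by
  refine Finset.sum_congr rfl fun j hj => ?_
  rw [Finset.mem_Icc] at hj
  rw [h _ (by omega), h _ (by omega)]
  congr 1
  refine Finset.sum_congr rfl fun l hl => h l ?_
  have := Finset.mem_range.1 hl
  omega

lemma signC_even_succ (e : ℕ → ℕ) (s : ℕ) : signC (2 * (s + 1)) e =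
    signC (2 * s) e + (e (2 * s + 2) + e (2 * s + 1)) * ∑ l ∈ Finset.range (2 * s + 2), e l := by
  rw [signC, signC, show 2 * (s + 1) / 2 = s + 1 by omega, show 2 * s / 2 = s by omega,
    Finset.sum_Icc_succ_top (by omega)]
  rfl

lemma signC_odd (e : ℕ → ℕ) (s : ℕ) : signC (2 * s + 1) e = signC (2 * s) e := by
  rw [signC, signC, show (2 * s + 1) / 2 = s by omega, show 2 * s / 2 = s by omega]

/-- The top index occurs only in the last summand of `C`, linearly with coefficient `∑ l < 2s, e l`.
Written with additions on both sides to stay within natural numbers. -/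
lemma signC_add_eq {e e' : ℕ → ℕ} (s : ℕ) (h : ∀ k < 2 * s, e k = e' k) :
    signC (2 * s) e + e' (2 * s) * ∑ l ∈ Finset.range (2 * s), e l =
      signC (2 * s) e' + e (2 * s) * ∑ l ∈ Finset.range (2 * s), e l := by
  obtain _ | s := s
  · simp [signC]
  · have h1 : signC (2 * s) e = signC (2 * s) e' := signC_congr fun k hk => h k (by omega)
    have h2 : ∑ l ∈ Finset.range (2 * s + 2), e l = ∑ l ∈ Finset.range (2 * s + 2), e' l :=
      Finset.sum_congr rfl fun l hl => h l (by have := Finset.mem_range.1 hl; omega)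
    rw [signC_even_succ, signC_even_succ, h1, h (2 * s + 1) (by omega), ← h2,
      show 2 * (s + 1) = 2 * s + 2 by ring]
    ring

section

variable {e e' : ℕ → ℕ} {m p q r : ℕ}

lemma sum_range_congr_of_lt {f g : ℕ → ℕ} {s : ℕ} (h : ∀ j < s, f j = g j) :
    ∑ j ∈ Finset.range s, f j = ∑ j ∈ Finset.range s, g j :=
  Finset.sum_congr rfl fun j hj => h j (Finset.mem_range.1 hj)

/-- The recursion for the sign of the explicit formula, for even `n`. -/
lemma sign_succ_even {s : ℕ} (hm : r + p + q = m) (h : ∀ k < 2 * s, e k = e' k)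
    (h1 : e (2 * s) = r + q) (h2 : e' (2 * s) + 1 = r) (h3 : e' (2 * s + 1) + q = m) :
    ((r + q * (p + 1) + 1 + (signA (2 * s) + signB (2 * s) (m + 1) e + signC (2 * s) e +
      signD (2 * s) (m + 1) e) : ℕ) : ZMod 2) =
    ((signA (2 * s + 1) + signB (2 * s + 1) m e' + signC (2 * s + 1) e' +
      signD (2 * s + 1) m e' : ℕ) : ZMod 2) := by
  have hD : signD (2 * s) (m + 1) e = 0 := if_neg (by simp)
  have hD' : signD (2 * s + 1) m e' = (m + e' (2 * s + 1)) *
      (∑ l ∈ Finset.range (2 * s), e l + e' (2 * s) + e' (2 * s + 1)) := by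
    rw [signD, if_pos (by simp), Finset.sum_range_succ, Finset.sum_range_succ,
      sum_range_congr_of_lt h]
  have hC := congrArg (Nat.cast : ℕ → ZMod 2) (signC_add_eq s h)
  have hE : ∑ j ∈ Finset.range s, e' (2 * j) = ∑ j ∈ Finset.range s, e (2 * j) :=
    sum_range_congr_of_lt fun j hj => (h _ (by omega)).symm
  have hO : ∑ j ∈ Finset.range s, e' (2 * j + 1) = ∑ j ∈ Finset.range s, e (2 * j + 1) :=
    sum_range_congr_of_lt fun j hj => (h _ (by omega)).symm
  have h2' : (e' (2 * s) : ZMod 2) = r + 1 := by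
    rw [← h2]; push_cast; generalize (e' (2 * s) : ZMod 2) = x; revert x; decide
  have h3' : (e' (2 * s + 1) : ZMod 2) = r + p := by
    rw [show e' (2 * s + 1) = r + p by omega]; push_cast; rfl
  have h1' : (e (2 * s) : ZMod 2) = r + q := by rw [h1]; push_cast; rfl
  have hm' : (m : ZMod 2) = r + p + q := by rw [← hm]; push_cast; rfl
  rw [hD, hD', signC_odd, signB, signB, show (2 * s) / 2 = s by omega,
    show (2 * s + 1) / 2 = s by omega, show (2 * s + 1 + 1) / 2 = s + 1 by omega,
    Finset.sum_range_succ, Finset.sum_range_succ, Finset.sum_range_succ, hE, hO,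
    sum_range_two_mul]
  rw [sum_range_two_mul] at hC
  push_cast [h1', h2', h3', hm'] at hC
  -- `A` depends on the degree modulo 8 and the shape of `B` on it modulo 4. In each case both sides
  -- become polynomials over `ZMod 2` in finitely many unknowns, compared by evaluating at all
  -- values, with `hC` as a side condition.
  have hs : ((2 * s) % 8 = 0 ∧ (2 * s + 1) % 8 = 1 ∧ (2 * s) % 4 = 0 ∧ (2 * s + 1) % 4 = 1) ∨
      ((2 * s) % 8 = 2 ∧ (2 * s + 1) % 8 = 3 ∧ (2 * s) % 4 = 2 ∧ (2 * s + 1) % 4 = 3) ∨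
      ((2 * s) % 8 = 4 ∧ (2 * s + 1) % 8 = 5 ∧ (2 * s) % 4 = 0 ∧ (2 * s + 1) % 4 = 1) ∨
      ((2 * s) % 8 = 6 ∧ (2 * s + 1) % 8 = 7 ∧ (2 * s) % 4 = 2 ∧ (2 * s + 1) % 4 = 3) := by
    omega
  revert hC
  rcases hs with ⟨h4, h5, h6, h7⟩ | ⟨h4, h5, h6, h7⟩ | ⟨h4, h5, h6, h7⟩ | ⟨h4, h5, h6, h7⟩ <;>
    simp only [signA, h4, h5, h6, h7, Nat.reduceEqDiff, or_true, or_false,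
      if_true, if_false] <;>
    push_cast [h1', h2', h3', hm', show (2 : ZMod 2) = 0 from rfl, zero_mul] <;>
    generalize (signC (2 * s) e : ZMod 2) = c <;>
    generalize (signC (2 * s) e' : ZMod 2) = c' <;>
    generalize (∑ j ∈ Finset.range s, (e (2 * j) : ZMod 2)) = E <;>
    generalize (∑ j ∈ Finset.range s, (e (2 * j + 1) : ZMod 2)) = O <;>
    generalize (r : ZMod 2) = r, (p : ZMod 2) = p, (q : ZMod 2) = q <;>
    clear * - <;> revert c c' E O r p q <;> decide

/-- The recursion for the sign of the explicit formula, for odd `n`. -/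
lemma sign_succ_odd {s : ℕ} (hm : r + p + q = m) (h : ∀ k < 2 * s + 1, e k = e' k)
    (h1 : e (2 * s + 1) = r + q) (h2 : e' (2 * s + 1) + 1 = r)
    (h3 : e' (2 * s + 2) + q = m) :
    ((r + q * (p + 1) + 1 + (signA (2 * s + 1) + signB (2 * s + 1) (m + 1) e +
      signC (2 * s + 1) e + signD (2 * s + 1) (m + 1) e) : ℕ) : ZMod 2) =
    ((signA (2 * s + 2) + signB (2 * s + 2) m e' + signC (2 * s + 2) e' +
      signD (2 * s + 2) m e' : ℕ) : ZMod 2) := by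
  have hT : ∑ l ∈ Finset.range (2 * s + 1), e' l = ∑ l ∈ Finset.range (2 * s + 1), e l :=
    (sum_range_congr_of_lt h).symm
  have hD' : signD (2 * s + 2) m e' = 0 := if_neg (by simp [Nat.even_add])
  have hD : signD (2 * s + 1) (m + 1) e = (m + 1 + e (2 * s + 1)) *
      (∑ l ∈ Finset.range (2 * s + 1), e l + e (2 * s + 1)) := by
    rw [signD, if_pos (by simp), Finset.sum_range_succ]
  -- Here `e_n` has odd index `2s + 1` and does not enter `C` at level `n`; passing to `n + 1` just
  -- adds one summand.
  have hC : signC (2 * s + 2) e' = signC (2 * s) e + (e' (2 * s + 2) + e' (2 * s + 1)) *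
      (∑ l ∈ Finset.range (2 * s + 1), e l + e' (2 * s + 1)) := by
    rw [show 2 * s + 2 = 2 * (s + 1) by ring, signC_even_succ, Finset.sum_range_succ, hT,
      signC_congr fun k hk => (h k (by omega)).symm]
    rfl
  have hE : ∑ j ∈ Finset.range (s + 1), e' (2 * j) = ∑ j ∈ Finset.range (s + 1), e (2 * j) :=
    sum_range_congr_of_lt fun j hj => (h _ (by omega)).symm
  have hO : ∑ j ∈ Finset.range s, e' (2 * j + 1) = ∑ j ∈ Finset.range s, e (2 * j + 1) :=
    sum_range_congr_of_lt fun j hj => (h _ (by omega)).symm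
  have h2' : (e' (2 * s + 1) : ZMod 2) = r + 1 := by
    rw [← h2]; push_cast; generalize (e' (2 * s + 1) : ZMod 2) = x; revert x; decide
  have h3' : (e' (2 * s + 2) : ZMod 2) = r + p := by
    rw [show e' (2 * s + 2) = r + p by omega]; push_cast; rfl
  have h1' : (e (2 * s + 1) : ZMod 2) = r + q := by rw [h1]; push_cast; rfl
  have hm' : (m : ZMod 2) = r + p + q := by rw [← hm]; push_cast; rfl
  have hE' : ∑ j ∈ Finset.range (s + 1), e (2 * j) =
    ∑ j ∈ Finset.range s, e (2 * j) + e (2 * s) := Finset.sum_range_succ _ _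
  rw [hD, hD', hC, signC_odd, signB, signB, show (2 * s + 1) / 2 = s by omega,
    show (2 * s + 1 + 1) / 2 = s + 1 by omega,
    show (2 * s + 2 + 1) / 2 = s + 1 by omega, Finset.sum_range_succ _ (s + 1), hE,
    Finset.sum_range_succ (fun j => e (2 * j + 1)), Finset.sum_range_succ (fun j => e' (2 * j + 1)),
    hO, Finset.sum_range_succ _ (2 * s), sum_range_two_mul, hE',
    show 2 * (s + 1) = 2 * s + 2 by ring]
  have hs : ((2 * s + 1) % 8 = 1 ∧ (2 * s + 2) % 8 = 2 ∧ (2 * s + 1) % 4 = 1 ∧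
        (2 * s + 2) % 4 = 2) ∨
      ((2 * s + 1) % 8 = 3 ∧ (2 * s + 2) % 8 = 4 ∧ (2 * s + 1) % 4 = 3 ∧
        (2 * s + 2) % 4 = 0) ∨
      ((2 * s + 1) % 8 = 5 ∧ (2 * s + 2) % 8 = 6 ∧ (2 * s + 1) % 4 = 1 ∧
        (2 * s + 2) % 4 = 2) ∨
      ((2 * s + 1) % 8 = 7 ∧ (2 * s + 2) % 8 = 0 ∧ (2 * s + 1) % 4 = 3 ∧
        (2 * s + 2) % 4 = 0) := by
    omega
  rcases hs with ⟨h4, h5, h6, h7⟩ | ⟨h4, h5, h6, h7⟩ | ⟨h4, h5, h6, h7⟩ | ⟨h4, h5, h6, h7⟩ <;>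
    simp only [signA, h4, h5, h6, h7, Nat.reduceEqDiff, or_true, or_false,
      if_true, if_false] <;>
    push_cast [h1', h2', h3', hm', show (2 : ZMod 2) = 0 from rfl, zero_mul] <;>
    generalize (signC (2 * s) e : ZMod 2) = c <;>
    generalize (∑ j ∈ Finset.range s, (e (2 * j) : ZMod 2)) = E <;>
    generalize (∑ j ∈ Finset.range s, (e (2 * j + 1) : ZMod 2)) = O <;>
    generalize (e (2 * s) : ZMod 2) = x <;>
    generalize (r : ZMod 2) = r, (p : ZMod 2) = p, (q : ZMod 2) = q <;>
    clear * - <;> revert c E O x r p q <;> decide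

end

lemma neg_one_pow_congr {R : Type v} [CommRing R] {k l : ℕ} (h : (k : ZMod 2) = l) :
    (-1 : R) ^ k = (-1) ^ l := by
  rw [neg_one_pow_eq_pow_mod_two, (ZMod.natCast_eq_natCast_iff k l 2).1 h,
    ← neg_one_pow_eq_pow_mod_two]

lemma IndexRel.sign {n m p q : ℕ} (h : p + q < m) {i : Fin (n + 1) → ℕ}
    {i' : Fin (n + 1 + 1) → ℕ} (hr : IndexRel (m := m) p q i i') (R : Type v) [CommRing R] :
    (-1 : R) ^ (m - p - q + (Shuffle.last (p + 1) q).sig + 1) * (-1) ^ signExp (m + 1) i =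
      (-1) ^ signExp m i' := by
  rw [← pow_add, Shuffle.sig_last]
  apply neg_one_pow_congr
  have hm : m - p - q + p + q = m := by omega
  rcases Nat.even_or_odd' n with ⟨s, rfl | rfl⟩
  · exact sign_succ_even hm hr.eq_of_lt hr.last hr.last' hr.top'
  · exact sign_succ_odd hm hr.eq_of_lt hr.last hr.last' hr.top'

/-! ### The correspondence of index tuples -/

lemma extIdx_fin {n m : ℕ} (e : ℕ → ℕ) (k : ℕ) :
    extIdx m (fun j : Fin (n + 1) => e j) k = if k < n + 1 then e k else m + 1 := by
  unfold extIdx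
  split_ifs <;> rfl

lemma indices_ext {n m : ℕ} {i j : indices n m}
    (h : ∀ k < n + 1, extIdx m i.1 k = extIdx m j.1 k) : i = j := by
  refine Subtype.ext (funext fun k => ?_)
  have hk := h k k.2
  rwa [extIdx, extIdx, dif_pos k.2, dif_pos k.2] at hk

/-- For fixed `p` and `q` the entries not shared by the two tuples are prescribed, so each tuple
determines the other. -/
lemma IndexRel.unique {n m p q : ℕ} {i i₁ : indices n (m + 1)} {j j₁ : indices (n + 1) m}
    (h : IndexRel (m := m) p q i.1 j.1) (h₁ : IndexRel (m := m) p q i₁.1 j₁.1) :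
    i = i₁ ↔ j = j₁ := by
  have h1 := h.last
  have h2 := h.last'
  have h3 := h.top'
  have h1' := h₁.last
  have h2' := h₁.last'
  have h3' := h₁.top'
  constructor
  · rintro rfl
    refine indices_ext fun k hk => ?_
    rcases lt_trichotomy k n with hk' | rfl | hk'
    · rw [← h.eq_of_lt k hk', ← h₁.eq_of_lt k hk']
    · omega
    · obtain rfl : k = n + 1 := by omega
      omega
  · rintro rfl
    refine indices_ext fun k hk => ?_
    rcases lt_trichotomy k n with hk' | rfl | hk'
    · rw [h.eq_of_lt k hk', h₁.eq_of_lt k hk']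
    · omega
    · omega

/-- The two top entries are replaced by the single entry `m̄ + q`, with `m̄ = m - p - q`. -/
lemma exists_indexRel {n m p q : ℕ} (j : indices (n + 1) m)
    (h : extIdx m j.1 n + 1 = m - p - q) (h' : extIdx m j.1 (n + 1) + q = m) :
    ∃ i : indices n (m + 1), IndexRel (m := m) p q i.1 j.1 := by
  have hj := mem_indices.1 j.2
  have e1 := extIdx_fin (n := n) (m := m + 1)
    (fun k => if k < n then extIdx m j.1 k else m - p - q + q)
  refine ⟨⟨fun k => if (k : ℕ) < n then extIdx m j.1 k else m - p - q + q,
    mem_indices.2 fun k hk => ?_⟩, fun k hk => ?_, ?_, h, h'⟩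
  · rw [e1, e1]
    have := hj k (by omega)
    rcases lt_trichotomy (k + 1) n with hk' | rfl | hk'
    · simp [hk, hk', show k < n by omega, this]
    · simp; omega
    · simp [hk, show ¬ k < n by omega, show ¬ k + 1 < n + 1 by omega]
      omega
  · rw [e1]; simp [hk, show k < n + 1 by omega]
  · rw [e1]; simp

/-- The top entry is replaced by `m̄ - 1` and `m - q`; the bounds in `h'` keep the tuple increasing.
-/
lemma exists_indexRel' {n m p q : ℕ} (hpq : p + q < m) (i : indices n (m + 1))
    (h : extIdx (m + 1) i.1 n = m - p - q + q)
    (h' : ∀ k < n, extIdx (m + 1) i.1 k + 1 < m - p - q) :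
    ∃ j : indices (n + 1) m, IndexRel (m := m) p q i.1 j.1 := by
  have hi := mem_indices.1 i.2
  have e1 := extIdx_fin (n := n + 1) (m := m) (fun k => if k < n then extIdx (m + 1) i.1 k else
    if k = n then m - p - q - 1 else m - q)
  refine ⟨⟨fun k => if (k : ℕ) < n then extIdx (m + 1) i.1 k else
    if (k : ℕ) = n then m - p - q - 1 else m - q,
    mem_indices.2 fun k hk => ?_⟩, fun k hk => ?_, h, ?_, ?_⟩
  · rw [e1, e1]
    rcases lt_trichotomy k n with hk' | rfl | hk'
    · have h1 := hi k (by omega)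
      have h2 := h' k hk'
      simp only [hk, hk', if_true, show k + 1 < n + 1 + 1 by omega]
      split_ifs <;> omega
    · simp; omega
    · obtain rfl : k = n + 1 := by omega
      simp
  · rw [e1, if_pos (by omega), if_pos hk]
  · rw [e1]; simp; omega
  · rw [e1]; simp; omega

/-! ### Assembling the induction -/

/-- The contribution to `h_{n+1} (a × b)` of the part of the Shih operator with parameters
`p` and `q`. -/
lemma sum_shuffle_hTerm (R : Type v) [CommRing R] {X : SSet.{u}} {n m p q : ℕ} (h : p + q < m)
    (a b : Simplex X m) (hd : m + 1 + n = m + (n + 1)) :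
    ∑ S : Shuffle (p + 1) q, ((-1 : R) ^ (m - p - q + S.sig + 1)) • castDeg R X X hd
      (∑ i : indices n (m + 1), ((-1 : R) ^ signExp (m + 1) i.1) •
        hTerm R i (shiSnd X p q h S b) (shiFst X p q h S a)) =
    ∑ j : indices (n + 1) m,
      if extIdx m j.1 n + 1 = m - p - q ∧ extIdx m j.1 (n + 1) + q = m then
        ((-1 : R) ^ signExp m j.1) • hTerm R j a b else 0 := by
  rw [Finset.sum_eq_single (Shuffle.last (p + 1) q)]
  · rw [← Finset.sum_filter, map_sum, Finset.smul_sum]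
    have hrel : ∀ j ∈ Finset.univ.filter (fun j : indices (n + 1) m =>
        extIdx m j.1 n + 1 = m - p - q ∧ extIdx m j.1 (n + 1) + q = m),
        ∃ i : indices n (m + 1), IndexRel (m := m) p q i.1 j.1 := fun j hj =>
      exists_indexRel j (Finset.mem_filter.1 hj).2.1 (Finset.mem_filter.1 hj).2.2
    choose f hf using hrel
    have hterm : ∀ (i : indices n (m + 1)) (j : indices (n + 1) m),
        IndexRel (m := m) p q i.1 j.1 → ((-1 : R) ^ signExp m j.1) • hTerm R j a b =
        ((-1 : R) ^ (m - p - q + (Shuffle.last (p + 1) q).sig + 1)) • castDeg R X X hd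
          (((-1 : R) ^ signExp (m + 1) i.1) • hTerm R i
            (shiSnd X p q h (Shuffle.last (p + 1) q) b)
            (shiFst X p q h (Shuffle.last (p + 1) q) a)) := by
      intro i j hr
      rw [map_smul, smul_smul, hr.sign h, castDeg_shi_hTerm R h i j hr]
    symm
    -- Tuples `i` related to no `j` exist, but their terms vanish, so the correspondence need only
    -- be bijective on nonzero terms.
    refine Finset.sum_bij_ne_zero (fun j hj _ => f j hj) (fun _ _ _ => Finset.mem_univ _)
      (fun j hj _ j₁ hj₁ _ e => ((hf j hj).unique (hf j₁ hj₁)).1 e) (fun i _ hne => ?_)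
      (fun j hj _ => hterm _ _ (hf j hj))
    have hne' : hTerm R i (shiSnd X p q h (Shuffle.last (p + 1) q) b)
        (shiFst X p q h (Shuffle.last (p + 1) q) a) ≠ 0 := by
      intro h0
      exact hne (by rw [h0, smul_zero, map_zero, smul_zero])
    obtain ⟨h1, h2, -⟩ := shi_hTerm_ne_zero R h _ i a b hne'
    obtain ⟨j, hj⟩ := exists_indexRel' h i h1 h2
    have hmem : j ∈ Finset.univ.filter (fun j : indices (n + 1) m =>
        extIdx m j.1 n + 1 = m - p - q ∧ extIdx m j.1 (n + 1) + q = m) :=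
      Finset.mem_filter.2 ⟨Finset.mem_univ _, hj.last', hj.top'⟩
    exact ⟨j, hmem, by rwa [hterm i j hj], ((hf j hmem).unique hj).2 rfl⟩
  · intro S _ hS
    rw [Finset.sum_eq_zero, map_zero, smul_zero]
    intro i _
    by_contra hne
    exact hS (shi_hTerm_ne_zero R h S i a b fun h0 => hne (by rw [h0, smul_zero])).2.2
  · exact fun h0 => (h0 (Finset.mem_univ _)).elim

lemma swap_SHI_cls (R : Type v) [CommRing R] {X : SSet.{u}} {m : ℕ} (a b : Simplex X m) :
    swap R X (m + 1) (SHI R X X m (cls R (pair a b))) =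
      ∑ q : Fin m, ∑ p : Fin (m - q), ∑ S : Shuffle ((p : ℕ) + 1) q,
        ((-1 : R) ^ (m - p - q + S.sig + 1)) •
          cls R (pair (shiSnd X p q (by omega) S b) (shiFst X p q (by omega) S a)) := by
  have h1 : SHI R X X m (cls R (pair a b)) = shiVal R a b := liftN_cls R _ _ _
  rw [h1, shiVal]
  simp only [map_sum, map_smul]
  refine Finset.sum_congr rfl fun q _ => Finset.sum_congr rfl fun p _ =>
    Finset.sum_congr rfl fun S _ => ?_
  congr 1
  exact liftN_cls R _ _ _

lemma tcls_faces_congr (R : Type v) [CommRing R] {X : SSet.{u}} {m k : ℕ} {l l' r r' : List ℕ}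
    (hl : l = l') (hr : r = r') (a b : Simplex X m) (h : m - l.length + (m - r.length) = k)
    (h' : m - l'.length + (m - r'.length) = k) :
    tcls R h (faces X l a) (faces X r b) = tcls R h' (faces X l' a) (faces X r' b) := by
  subst hl hr
  rfl

lemma AW_cls (R : Type v) [CommRing R] {X : SSet.{u}} {m : ℕ} (a b : Simplex X m) :
    AW R X X m (cls R (pair a b)) =
      ∑ i : indices 0 m, ((-1 : R) ^ signExp m i.1) • hTerm R i a b := by
  have h1 : AW R X X m (cls R (pair a b)) = awVal R a b := liftN_cls R _ _ _
  rw [h1, awVal]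
  have hmem : ∀ i : Fin (m + 1), (fun _ => (i : ℕ)) ∈ indices 0 m := by
    intro i
    refine mem_indices.2 fun k hk => ?_
    obtain rfl : k = 0 := by omega
    simp [extIdx, Nat.lt_succ_iff.1 i.2]
  refine Fintype.sum_bijective (fun i => (⟨_, hmem i⟩ : indices 0 m)) ⟨?_, ?_⟩ _ _ ?_
  · intro i j hij
    exact Fin.ext (congrFun (congrArg Subtype.val hij) 0)
  · intro i
    have hi := extIdx_le i.2 (Nat.zero_le 0)
    refine ⟨⟨extIdx m i.1 0, by omega⟩, indices_ext fun k hk => ?_⟩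
    obtain rfl : k = 0 := by omega
    simp [extIdx]
  · intro i
    -- For `n = 0` every part of the exponent is zero, including `n * m` and the empty sum in `B`.
    have hs : signExp m (fun _ : Fin (0 + 1) => (i : ℕ)) = 0 := by
      simp [signExp, signA, signB, signC, signD]
    rw [hs, pow_zero, one_smul, hTerm, if_pos (by simp)]
    refine tcls_faces_congr R ?_ ?_ a b _ _
    · simp [leftFaces, block, extIdx]
    · simp [rightFaces, extIdx]

/-- Both parities are proved at once, since `hTerm` records the exchange of arguments. The degree
`m` must vary in the induction because `SHI` raises it by one. -/
lemma hMap_cls (R : Type v) [CommRing R] {X : SSet.{u}} (n m : ℕ) (a b : Simplex X m) :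
    hMap R X n m (cls R (pair a b)) =
      ∑ i : indices n m, ((-1 : R) ^ signExp m i.1) • hTerm R i a b := by
  induction n generalizing m with
  | zero => exact AW_cls R a b
  | succ n ih =>
    rw [hMap_succ', swap_SHI_cls]
    have hd : m + 1 + n = m + (n + 1) := by omega
    have hstep : ∀ (q : Fin m) (p : Fin (m - q)), castDeg R X X hd (hMap R X n (m + 1)
        (∑ S : Shuffle ((p : ℕ) + 1) q, ((-1 : R) ^ (m - p - q + S.sig + 1)) •
          cls R (pair (shiSnd X p q (by omega) S b) (shiFst X p q (by omega) S a)))) =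
        ∑ j : indices (n + 1) m,
          if extIdx m j.1 n + 1 = m - p - q ∧ extIdx m j.1 (n + 1) + q = m then
            ((-1 : R) ^ signExp m j.1) • hTerm R j a b else 0 := by
      intro q p
      rw [← sum_shuffle_hTerm R (show (p : ℕ) + q < m by omega) a b hd, map_sum, map_sum]
      refine Finset.sum_congr rfl fun S _ => ?_
      rw [map_smul, map_smul, ih]
    simp_rw [map_sum] at hstep ⊢
    simp_rw [hstep]
    rw [Finset.sum_congr rfl fun q _ => Finset.sum_comm, Finset.sum_comm]
    refine Finset.sum_congr rfl fun j _ => ?_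
    have h1 := mem_indices.1 j.2 n (by omega)
    have h2 := extIdx_le j.2 (le_refl (n + 1))
    -- For a given tuple `j` the only contributing summand of `SHI` has `q = m - j_{n+1}` and `p =
    -- j_{n+1} - j_n - 1`, so that `m - p - q = j_n + 1`.
    rw [Finset.sum_eq_single ⟨m - extIdx m j.1 (n + 1), by omega⟩,
      Finset.sum_eq_single ⟨extIdx m j.1 (n + 1) - extIdx m j.1 n - 1, by simp; omega⟩, if_pos]
    · exact ⟨by simp; omega, by simp; omega⟩
    · intro p _ hp
      refine if_neg fun h => hp (Fin.ext ?_)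
      have := h.1
      simp at this ⊢
      omega
    · exact fun h => (h (Finset.mem_univ _)).elim
    · intro q _ hq
      refine Finset.sum_eq_zero fun p _ => if_neg fun h => hq (Fin.ext ?_)
      have := h.2
      simp
      omega
    · exact fun h => (h (Finset.mem_univ _)).elim

end EilenbergZilber

theorem theorem3p1 {R : Type v} [CommRing R] (X : SSet.{u}) (n m : ℕ)
    (a b : EilenbergZilber.Simplex X m) :
    (Even n →
      EilenbergZilber.hMap R X n m (EilenbergZilber.cls R (EilenbergZilber.pair a b)) =
        ∑ i : EilenbergZilber.indices n m,
          ((-1 : R) ^ EilenbergZilber.signExp m i.1) •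
            EilenbergZilber.tcls R (EilenbergZilber.degree_eq i)
              (EilenbergZilber.faces X (EilenbergZilber.leftFaces m i.1) a)
              (EilenbergZilber.faces X (EilenbergZilber.rightFaces m i.1) b)) ∧
    (Odd n →
      EilenbergZilber.hMap R X n m (EilenbergZilber.cls R (EilenbergZilber.pair a b)) =
        ∑ i : EilenbergZilber.indices n m,
          ((-1 : R) ^ EilenbergZilber.signExp m i.1) •
            EilenbergZilber.tcls R (EilenbergZilber.degree_eq i)
              (EilenbergZilber.faces X (EilenbergZilber.leftFaces m i.1) b)
              (EilenbergZilber.faces X (EilenbergZilber.rightFaces m i.1) a)) := by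
  rw [EilenbergZilber.hMap_cls]
  refine ⟨fun hn => Finset.sum_congr rfl fun i _ => ?_,
    fun hn => Finset.sum_congr rfl fun i _ => ?_⟩
  · rw [EilenbergZilber.hTerm, if_pos hn]
  · rw [EilenbergZilber.hTerm, if_neg (Nat.not_even_iff_odd.2 hn)]
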